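/- Let $\mathcal A>0$, let $\Omega=\{x\in\mathbb R^2:\ \mathcal A/2<\|x\|<1+\mathcal A/2\}$ with Cartesian coordinates $x=(y,z)$, $r=\|x\|$, and let $b=\ln(1+2/\mathcal A)$. All functions are real-valued and $(\cdot,\cdot)$ is the scalar product of $L_2(\Omega)$. Let $H^1_0(\Omega)$ be the closure of $C_c^\infty(\Omega)$ in the Sobolev space $W^1_2(\Omega)$, and let $V$ be the closure in $W^1_2(\Omega)^2$ of the divergence-free vector fields in $C_c^\infty(\Omega)^2$. Put $$(u,v)_D=\sum_{k}(\partial_k u,\partial_k v)\quad\text{for scalar functions},\qquad (u,v)_D=\sum_{j,k}(\partial_k u_j,\partial_k v_j)\quad\text{for vector fields},$$ and, for $(w,\theta)\in V\times H^1_0(\Omega)$, with $w_z$ the vertical component $w\cdot e_z$ and $w_r=w\cdot x/\|x\|$ the radial component of $w$, $$F(w,\theta)=(\theta,w_z)+\frac1b\Big(\theta,\frac{w_r}{r}\Big),\qquad D(w,\theta)=(w,w)_D+(\theta,\theta)_D .$$ Then the supremum $$\frac1{\mathrm{Ra}_c}:=\sup\Big\{\frac{F(w,\theta)}{D(w,\theta)}:\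 (w,\theta)\in V\times H^1_0(\Omega),\ (w,\theta)\neq(0,0)\Big\}$$ is finite and positive, and it is attained at some nonzero pair in $V\times H^1_0(\Omega)$. Every nonzero pair $(w,\theta)\in V\times H^1_0(\Omega)$ at which it is attained is a critical point of $F/D$, that is, for all $(u,\sigma)\in V\times H^1_0(\Omega)$ the function $\eta\mapsto F(w+\eta u,\theta+\eta\sigma)/D(w+\eta u,\theta+\eta\sigma)$ has derivative $0$ at $\eta=0$, and it satisfies the weak Euler–Lagrange equations with $\lambda=2/\mathrm{Ra}_c$: for all $(u,\sigma)\in V\times H^1_0(\Omega)$, $$(\sigma,w_z)+(\theta,u_z)+\frac1b\Big(\Big(\theta,\frac{u_r}{r}\Big)+\Big(\sigma,\frac{w_r}{r}\Big)\Big)=\lambda\big((u,w)_D+(\theta,\sigma)_D\big).$$ -/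

import Mathlib

open MeasureTheory TopologicalSpace
open scoped Distributions ENNReal

noncomputable section

namespace AnnulusConvection

/-- The Euclidean plane; coordinate `0` is the horizontal coordinate `y`, coordinate `1` is the
vertical coordinate `z`. -/
abbrev Plane : Type := EuclideanSpace ℝ (Fin 2)

/-- The Cartesian unit vectors of the plane. -/
def cart (k : Fin 2) : Plane := EuclideanSpace.single k 1

/-- The real Lebesgue space `L₂(Ω)`. -/
abbrev L2 (Ω : Opens Plane) : Type := Lp ℝ 2 (volume.restrict (Ω : Set Plane))

/-- `g` is the weak partial derivative `∂u/∂x_k` on `Ω`. -/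
def IsWeakPartial (Ω : Opens Plane) (k : Fin 2) (u g : L2 Ω) : Prop :=
  ∀ φ : 𝓓(Ω, ℝ),
    ∫ x in (Ω : Set Plane), u x * fderiv ℝ φ x (cart k) = -∫ x in (Ω : Set Plane), g x * φ x

theorem memLp_test (Ω : Opens Plane) (φ : 𝓓(Ω, ℝ)) :
    MemLp φ 2 (volume.restrict (Ω : Set Plane)) :=
  (φ.continuous.memLp_of_hasCompactSupport φ.hasCompactSupport).restrict _

theorem memLp_test_partial (Ω : Opens Plane) (k : Fin 2) (φ : 𝓓(Ω, ℝ)) :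
    MemLp (fun x => fderiv ℝ φ x (cart k)) 2 (volume.restrict (Ω : Set Plane)) := by
  refine (Continuous.memLp_of_hasCompactSupport ?_ ?_).restrict _
  · exact (φ.contDiff.continuous_fderiv (by simp)).clm_apply continuous_const
  · exact φ.hasCompactSupport.fderiv_apply ℝ (cart k)

theorem integrable_mul_test (Ω : Opens Plane) (u : L2 Ω) {f : Plane → ℝ}
    (hf : MemLp f 2 (volume.restrict (Ω : Set Plane))) :
    Integrable (fun x => u x * f x) (volume.restrict (Ω : Set Plane)) :=
  (Lp.memLp u).integrable_mul hf

theorem integral_add_mul (Ω : Opens Plane) (u v : L2 Ω) {f : Plane → ℝ}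
    (hf : MemLp f 2 (volume.restrict (Ω : Set Plane))) :
    ∫ x in (Ω : Set Plane), (u + v) x * f x
      = (∫ x in (Ω : Set Plane), u x * f x) + ∫ x in (Ω : Set Plane), v x * f x := by
  rw [← integral_add (integrable_mul_test Ω u hf) (integrable_mul_test Ω v hf)]
  refine integral_congr_ae ?_
  filter_upwards [Lp.coeFn_add u v] with x hx
  rw [hx, Pi.add_apply, add_mul]

theorem integral_smul_mul (Ω : Opens Plane) (c : ℝ) (u : L2 Ω) (f : Plane → ℝ) :
    ∫ x in (Ω : Set Plane), (c • u) x * f x = c * ∫ x in (Ω : Set Plane), u x * f x := by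
  rw [← integral_const_mul]
  refine integral_congr_ae ?_
  filter_upwards [Lp.coeFn_smul c u] with x hx
  rw [hx, Pi.smul_apply, smul_eq_mul, mul_assoc]

/-- The Sobolev space `W₂¹(Ω)`: an element is a function `u ∈ L₂(Ω)` together with its (uniquely
determined) weak gradient `(∂₀u, ∂₁u)` in `L₂(Ω)²`. The norm inherited from the ambient Hilbert
space is `(‖u‖₂² + ‖∂₀u‖₂² + ‖∂₁u‖₂²)^{1/2}`. -/
def W12 (Ω : Opens Plane) :
    Submodule ℝ (WithLp 2 (L2 Ω × PiLp 2 (fun _ : Fin 2 => L2 Ω))) where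
  carrier := {U | ∀ k, IsWeakPartial Ω k U.fst (U.snd k)}
  zero_mem' := by
    intro k φ
    have h0 : ∀ f : Plane → ℝ, ∫ x in (Ω : Set Plane), (0 : L2 Ω) x * f x = 0 := by
      intro f
      simpa using integral_smul_mul Ω 0 0 f
    exact (h0 _).trans (neg_eq_zero.mpr (h0 _)).symm
  add_mem' := by
    intro U U' hU hU' k φ
    have h1 := hU k φ
    have h2 := hU' k φ
    simp only [WithLp.add_fst, WithLp.add_snd, PiLp.add_apply]
    rw [integral_add_mul Ω _ _ (memLp_test_partial Ω k φ),
      integral_add_mul Ω _ _ (memLp_test Ω φ), h1, h2]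
    ring
  smul_mem' := by
    intro c U hU k φ
    have h1 := hU k φ
    simp only [WithLp.smul_fst, WithLp.smul_snd, PiLp.smul_apply]
    rw [integral_smul_mul, integral_smul_mul, h1]
    ring

/-- The function underlying an element of `W₂¹(Ω)`. -/
def val {Ω : Opens Plane} (u : W12 Ω) : L2 Ω :=
  (u : WithLp 2 (L2 Ω × PiLp 2 (fun _ : Fin 2 => L2 Ω))).fst

/-- The weak partial derivatives of an element of `W₂¹(Ω)`. -/
def wderiv {Ω : Opens Plane} (k : Fin 2) (u : W12 Ω) : L2 Ω :=
  (u : WithLp 2 (L2 Ω × PiLp 2 (fun _ : Fin 2 => L2 Ω))).snd k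

/-- The elements of `W₂¹(Ω)` given by functions in `C_o^∞(Ω)`. -/
def testScalar (Ω : Opens Plane) : Submodule ℝ (W12 Ω) where
  carrier := {u | ∃ φ : 𝓓(Ω, ℝ), val u =ᵐ[volume.restrict (Ω : Set Plane)] φ}
  zero_mem' := ⟨0, Lp.coeFn_zero ℝ 2 (volume.restrict (Ω : Set Plane))⟩
  add_mem' := by
    rintro u v ⟨φ, hφ⟩ ⟨ψ, hψ⟩
    refine ⟨φ + ψ, ?_⟩
    have h : val (u + v) = val u + val v := rfl
    rw [h]
    filter_upwards [hφ, hψ, Lp.coeFn_add (val u) (val v)] with x h1 h2 h3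
    rw [h3, Pi.add_apply, h1, h2]
    rfl
  smul_mem' := by
    rintro c u ⟨φ, hφ⟩
    refine ⟨c • φ, ?_⟩
    have h : val (c • u) = c • val u := rfl
    rw [h]
    filter_upwards [hφ, Lp.coeFn_smul c (val u)] with x h1 h3
    rw [h3, Pi.smul_apply, h1]
    rfl

/-- The space of `W₂¹(Ω)`-functions vanishing on the boundary: the closure of `C_o^∞(Ω)` in
`W₂¹(Ω)`. -/
def W12o (Ω : Opens Plane) : Submodule ℝ (W12 Ω) := (testScalar Ω).topologicalClosure

/-- The space `W₂¹(Ω)²` of vector functions. -/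
abbrev W12vec (Ω : Opens Plane) : Type := PiLp 2 (fun _ : Fin 2 => W12 Ω)

/-- The divergence of a vector field on the plane. -/
def divergence (φ : Plane → Plane) (x : Plane) : ℝ := ∑ k, fderiv ℝ φ x (cart k) k

/-- The elements of `W₂¹(Ω)²` given by solenoidal vector fields in `C_o^∞(Ω)²`. -/
def testSolenoidal (Ω : Opens Plane) : Submodule ℝ (W12vec Ω) where
  carrier := {w | ∃ φ : 𝓓(Ω, Plane), (∀ x, divergence φ x = 0) ∧
    ∀ j, val (w j) =ᵐ[volume.restrict (Ω : Set Plane)] fun x => φ x j}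
  zero_mem' := by
    refine ⟨0, fun x => ?_, fun j => ?_⟩
    · have h : ((0 : 𝓓(Ω, Plane)) : Plane → Plane) = fun _ => 0 := rfl
      simp [divergence, h]
    · exact Lp.coeFn_zero ℝ 2 (volume.restrict (Ω : Set Plane))
  add_mem' := by
    rintro u v ⟨φ, hφd, hφ⟩ ⟨ψ, hψd, hψ⟩
    refine ⟨φ + ψ, fun x => ?_, fun j => ?_⟩
    · have h1 : DifferentiableAt ℝ φ x := (φ.contDiff.differentiable (by simp)) x
      have h2 : DifferentiableAt ℝ ψ x := (ψ.contDiff.differentiable (by simp)) x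
      have h : ((φ + ψ : 𝓓(Ω, Plane)) : Plane → Plane) = (φ : Plane → Plane) + ψ := rfl
      have e1 := hφd x
      have e2 := hψd x
      simp only [divergence] at e1 e2
      simp only [divergence, h, fderiv_add h1 h2, _root_.add_apply, PiLp.add_apply,
        Finset.sum_add_distrib, e1, e2, add_zero]
    · have h : val ((u + v) j) = val (u j) + val (v j) := rfl
      rw [h]
      filter_upwards [hφ j, hψ j, Lp.coeFn_add (val (u j)) (val (v j))] with x h1 h2 h3
      rw [h3, Pi.add_apply, h1, h2]
      rfl
  smul_mem' := by
    rintro c u ⟨φ, hφd, hφ⟩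
    refine ⟨c • φ, fun x => ?_, fun j => ?_⟩
    · have h1 : DifferentiableAt ℝ φ x := (φ.contDiff.differentiable (by simp)) x
      have h : ((c • φ : 𝓓(Ω, Plane)) : Plane → Plane) = c • (φ : Plane → Plane) := rfl
      have e1 := hφd x
      simp only [divergence] at e1
      simp only [divergence, h, fderiv_const_smul h1, _root_.smul_apply,
        PiLp.smul_apply, ← Finset.smul_sum, e1, smul_zero]
    · have h : val ((c • u) j) = c • val (u j) := rfl
      rw [h]
      filter_upwards [hφ j, Lp.coeFn_smul c (val (u j))] with x h1 h3
      rw [h3, Pi.smul_apply, h1]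
      rfl

/-- The space `V(Ω)`: the closure in `W₂¹(Ω)²` of the solenoidal fields in `C_o^∞(Ω)²`. -/
def V (Ω : Opens Plane) : Submodule ℝ (W12vec Ω) := (testSolenoidal Ω).topologicalClosure

/-- The annulus of gap width one with inverse relative gap width `A`. -/
def annulus (A : ℝ) : Opens Plane where
  carrier := {x | A / 2 < ‖x‖ ∧ ‖x‖ < 1 + A / 2}
  is_open' := (isOpen_lt continuous_const continuous_norm).inter
    (isOpen_lt continuous_norm continuous_const)

/-- The geometric parameter `b = ln (1 + 2/A)`. -/
def geomB (A : ℝ) : ℝ := Real.log (1 + 2 / A)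

/-- The space `X = V × W̊₂¹` on the annulus. -/
abbrev X (A : ℝ) : Type := V (annulus A) × W12o (annulus A)

/-- The `L₂(Ω)` scalar product. -/
def l2 (Ω : Opens Plane) (f g : Plane → ℝ) : ℝ := ∫ x in (Ω : Set Plane), f x * g x

/-- The Dirichlet scalar product of scalar functions. -/
def dirichlet {Ω : Opens Plane} (u v : W12 Ω) : ℝ := ∑ k, l2 Ω (wderiv k u) (wderiv k v)

/-- The Dirichlet scalar product of vector functions. -/
def dirichletVec {Ω : Opens Plane} (u v : W12vec Ω) : ℝ := ∑ j, dirichlet (u j) (v j)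

/-- The vertical component `w_z = w · e₃`. -/
def vertical {Ω : Opens Plane} (w : W12vec Ω) (x : Plane) : ℝ := val (w 1) x

/-- The radial component `w_r = w · x/|x|`. -/
def radial {Ω : Opens Plane} (w : W12vec Ω) (x : Plane) : ℝ := ∑ j, val (w j) x * (x j / ‖x‖)

/-- The bilinear form `(θ, w_z) + (1/b) (θ, w_r / r)`. -/
def buoyancy (A : ℝ) (w : W12vec (annulus A)) (θ : W12 (annulus A)) : ℝ :=
  l2 (annulus A) (val θ) (vertical w)
    + 1 / geomB A * l2 (annulus A) (val θ) (fun x => radial w x / ‖x‖)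

/-- The functional `F(w, θ)`. -/
def F (A : ℝ) (p : X A) : ℝ := buoyancy A p.1 p.2

/-- The functional `D(w, θ) = ‖w‖_D² + ‖θ‖_D²`. -/
def D (A : ℝ) (p : X A) : ℝ :=
  dirichletVec (p.1 : W12vec (annulus A)) p.1 + dirichlet (p.2 : W12 (annulus A)) p.2

/-- The values of `F / D` on the non-trivial pairs. -/
def ratios (A : ℝ) : Set ℝ := {t | ∃ p : X A, p ≠ 0 ∧ t = F A p / D A p}

/-- The critical Rayleigh number, `1 / Ra_c = sup F / D`. -/
def RaC (A : ℝ) : ℝ := 1 / sSup (ratios A)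

/-- The weak Euler-Lagrange equations of `F / D` with parameter `lam`, for the pair
`p = (w, θ)` and all variations `q = (u, σ)`. -/
def WeakEulerLagrange (A lam : ℝ) (p : X A) : Prop :=
  ∀ q : X A,
    buoyancy A p.1 q.2 + buoyancy A q.1 p.2
      = lam * (dirichletVec (q.1 : W12vec (annulus A)) p.1
          + dirichlet (p.2 : W12 (annulus A)) q.2)

end AnnulusConvection

end

open AnnulusConvection

noncomputable section

namespace AnnulusConvection

/-! ### Translation estimates and approximation by ball averages -/

section Translation

/-! This is the direct method for a quotient with coercive denominator and compact numerator.

Coercivity of `D` is the Poincaré inequality: a `C¹` function supported in a bounded set is compared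
with its translate by a vector that moves the set off itself. Compactness is Rellich's theorem:
averages over balls centred at a finite `h`-net approximate a test function in `L²` with error
`O(h)` times the norm of its gradient, so the embedding is a norm limit of finite rank operators.
Both estimates pass to the closures by continuity. On the annulus `r` is bounded below, so
multiplication by `x_j / r²` is bounded on `L²`, and the numerator is `⟪ι θ, T (w, θ)⟫` with `ι` the
embedding into `L²` and `T` bounded. Compactness of `ι` on the temperatures alone is then enough.

Let `M` be the supremum. The quadratic form `M D - F` is nonnegative, and the parallelogram identity
applied to it shows that a normalised maximising sequence, after passing to a subsequence, is Cauchy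
in norm (`exists_rayleigh_eq_sSup`); no weak convergence is needed. At a maximiser this form
vanishes, hence so does its first variation, which is the Euler–Lagrange equation. `M > 0` is shown
by a field that is vertical and constant on the support of a nonnegative bump temperature.
`coupled_rayleigh_quotient` joins these parts. -/

theorem sq_lintegral_le {α : Type*} [MeasurableSpace α] (ν : Measure α) {g : α → ℝ≥0∞}
    (hg : AEMeasurable g ν) : (∫⁻ x, g x ∂ν) ^ 2 ≤ ν Set.univ * ∫⁻ x, g x ^ 2 ∂ν := by
  have h := ENNReal.lintegral_mul_le_Lp_mul_Lq ν Real.HolderConjugate.two_two hg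
    (aemeasurable_const (b := (1 : ℝ≥0∞)))
  simp only [Pi.mul_apply, mul_one, lintegral_const, ENNReal.rpow_ofNat, one_pow, one_mul] at h
  calc (∫⁻ x, g x ∂ν) ^ 2
      ≤ ((∫⁻ x, g x ^ 2 ∂ν) ^ (1 / 2 : ℝ) * ν Set.univ ^ (1 / 2 : ℝ)) ^ 2 := by gcongr
    _ = ν Set.univ * ∫⁻ x, g x ^ 2 ∂ν := by
      rw [← ENNReal.mul_rpow_of_nonneg _ _ (by norm_num), ← ENNReal.rpow_ofNat, ← ENNReal.rpow_mul]
      norm_num [mul_comm]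

variable {E : Type*} [NormedAddCommGroup E] [NormedSpace ℝ E]

/-- Fundamental theorem of calculus along the segment from `x` to `x + z`, then Cauchy–Schwarz on
the unit interval. -/
theorem enorm_translate_sub_sq_le {f : E → ℝ} (hf : ContDiff ℝ 1 f) (x z : E) :
    ‖f (x + z) - f x‖ₑ ^ 2
      ≤ ‖z‖ₑ ^ 2 * ∫⁻ t in Set.Ioc (0 : ℝ) 1, ‖fderiv ℝ f (x + t • z)‖ₑ ^ 2 := by
  have hcf : Continuous (fderiv ℝ f) := hf.continuous_fderiv (by simp)
  have hc : Continuous fun t : ℝ => fderiv ℝ f (x + t • z) := by fun_prop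
  have hftc : ∫ t in (0 : ℝ)..1, fderiv ℝ f (x + t • z) z = f (x + z) - f x := by
    rw [intervalIntegral.integral_eq_sub_of_hasDerivAt (f := fun t : ℝ => f (x + t • z))]
    · simp
    · intro t _
      have h1 : HasDerivAt (fun t : ℝ => x + t • z) z t := by
        simpa using ((hasDerivAt_id t).smul_const z).const_add x
      exact ((hf.differentiable (by simp) _).hasFDerivAt).comp_hasDerivAt t h1
    · exact (hc.clm_apply continuous_const).intervalIntegrable _ _
  rw [← hftc, intervalIntegral.integral_of_le zero_le_one]
  calc ‖∫ t in Set.Ioc (0 : ℝ) 1, fderiv ℝ f (x + t • z) z‖ₑ ^ 2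
      ≤ (∫⁻ t in Set.Ioc (0 : ℝ) 1, ‖z‖ₑ * ‖fderiv ℝ f (x + t • z)‖ₑ) ^ 2 := by
        gcongr
        refine (enorm_integral_le_lintegral_enorm _).trans (lintegral_mono fun t => ?_)
        rw [mul_comm]
        exact ContinuousLinearMap.le_opENorm _ _
    _ ≤ _ := by
        refine (sq_lintegral_le _ (by fun_prop)).trans ?_
        simp only [mul_pow, Measure.restrict_apply_univ, Real.volume_Ioc, sub_zero,
          ENNReal.ofReal_one, one_mul]
        rw [lintegral_const_mul' _ _ (by simp)]

variable [MeasurableSpace E] [BorelSpace E] [FiniteDimensional ℝ E]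
  (μ : Measure E) [μ.IsAddHaarMeasure]

/-- After Tonelli, translation invariance makes the inner integral independent of `t`. -/
theorem lintegral_translate_sub_sq_le {f : E → ℝ} (hf : ContDiff ℝ 1 f) (z : E) :
    ∫⁻ x, ‖f (x + z) - f x‖ₑ ^ 2 ∂μ ≤ ‖z‖ₑ ^ 2 * ∫⁻ x, ‖fderiv ℝ f x‖ₑ ^ 2 ∂μ := by
  have hcf : Continuous (fderiv ℝ f) := hf.continuous_fderiv (by simp)
  have hc : Continuous fun p : E × ℝ => ‖fderiv ℝ f (p.1 + p.2 • z)‖ₑ :=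
    (hcf.comp (by fun_prop)).enorm
  calc ∫⁻ x, ‖f (x + z) - f x‖ₑ ^ 2 ∂μ
      ≤ ∫⁻ x, ‖z‖ₑ ^ 2 * ∫⁻ t in Set.Ioc (0 : ℝ) 1, ‖fderiv ℝ f (x + t • z)‖ₑ ^ 2 ∂volume ∂μ :=
        lintegral_mono fun x => enorm_translate_sub_sq_le hf x z
    _ = ‖z‖ₑ ^ 2 * ∫⁻ x, ∫⁻ t in Set.Ioc (0 : ℝ) 1, ‖fderiv ℝ f (x + t • z)‖ₑ ^ 2 ∂volume ∂μ :=
        lintegral_const_mul' _ _ (by simp)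
    _ = ‖z‖ₑ ^ 2 * ∫⁻ t in Set.Ioc (0 : ℝ) 1, ∫⁻ x, ‖fderiv ℝ f (x + t • z)‖ₑ ^ 2 ∂μ := by
        rw [lintegral_lintegral_swap]
        exact (hc.measurable.pow_const 2).aemeasurable
    _ = ‖z‖ₑ ^ 2 * ∫⁻ x, ‖fderiv ℝ f x‖ₑ ^ 2 ∂μ := by
        simp_rw [lintegral_add_right_eq_self (fun x => ‖fderiv ℝ f x‖ₑ ^ 2)]
        simp

/-- Replacing a function by its average over a ball of radius `h` close to the point. -/
theorem enorm_sub_average_sq_le {f : E → ℝ} (hf : Continuous f) {h : ℝ} (hh : 0 < h) {x c : E}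
    (hxc : dist x c < h) :
    ‖f x - ⨍ y in Metric.ball c h, f y ∂μ‖ₑ ^ 2
      ≤ (μ (Metric.ball 0 h))⁻¹ * ∫⁻ z in Metric.ball 0 (2 * h), ‖f (x + z) - f x‖ₑ ^ 2 ∂μ := by
  have hB0 : μ (Metric.ball c h) ≠ 0 := (Metric.measure_ball_pos μ c hh).ne'
  have hBt : μ (Metric.ball c h) ≠ ∞ := measure_ball_lt_top.ne
  have hfB : IntegrableOn f (Metric.ball c h) μ :=
    (hf.locallyIntegrable.integrableOn_isCompact (isCompact_closedBall c h)).mono_set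
      Metric.ball_subset_closedBall
  have hBr : μ.real (Metric.ball c h) ≠ 0 := (measureReal_ne_zero_iff hBt).2 hB0
  have hid : f x - ⨍ y in Metric.ball c h, f y ∂μ
      = -((μ.real (Metric.ball c h))⁻¹ * ∫ y in Metric.ball c h, (f y - f x) ∂μ) := by
    rw [setAverage_eq, integral_sub hfB (integrableOn_const hBt), setIntegral_const, smul_eq_mul,
      smul_eq_mul]
    field_simp
    ring
  -- Doubling the radius recentres the ball at `x`, so that the domain of the increment `z` depends
  -- on neither `x` nor `c`.
  have hsub : Metric.ball c h ⊆ Metric.ball x (2 * h) := by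
    intro y hy
    rw [Metric.mem_ball] at *
    linarith [dist_triangle_right y x c]
  have hshift : ∫⁻ y in Metric.ball x (2 * h), ‖f y - f x‖ₑ ^ 2 ∂μ
      = ∫⁻ z in Metric.ball 0 (2 * h), ‖f (x + z) - f x‖ₑ ^ 2 ∂μ := by
    rw [← lintegral_indicator Metric.isOpen_ball.measurableSet,
      ← lintegral_indicator Metric.isOpen_ball.measurableSet, ← lintegral_add_left_eq_self _ x]
    congr 1
    ext z
    simp [Set.indicator]
  have hinv : ‖(μ.real (Metric.ball c h))⁻¹‖ₑ = (μ (Metric.ball c h))⁻¹ := by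
    rw [enorm_inv hBr, Measure.real, Real.enorm_of_nonneg ENNReal.toReal_nonneg,
      ENNReal.ofReal_toReal hBt]
  rw [hid, enorm_neg, enorm_mul, mul_pow, hinv, ← hshift, ← Measure.addHaar_ball_center μ c]
  calc (μ (Metric.ball c h))⁻¹ ^ 2 * ‖∫ y in Metric.ball c h, (f y - f x) ∂μ‖ₑ ^ 2
      ≤ (μ (Metric.ball c h))⁻¹ ^ 2 * (∫⁻ y in Metric.ball c h, ‖f y - f x‖ₑ ∂μ) ^ 2 := by
        gcongr
        exact enorm_integral_le_lintegral_enorm _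
    _ ≤ (μ (Metric.ball c h))⁻¹ ^ 2
          * (μ (Metric.ball c h) * ∫⁻ y in Metric.ball c h, ‖f y - f x‖ₑ ^ 2 ∂μ) := by
        gcongr
        have hm : Continuous fun y => ‖f y - f x‖ₑ := (hf.sub continuous_const).enorm
        simpa using sq_lintegral_le (μ.restrict (Metric.ball c h)) hm.measurable.aemeasurable
    _ = (μ (Metric.ball c h))⁻¹ * ∫⁻ y in Metric.ball c h, ‖f y - f x‖ₑ ^ 2 ∂μ := by
        rw [sq, mul_assoc, ← mul_assoc _ (μ (Metric.ball c h)), ENNReal.inv_mul_cancel hB0 hBt,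
          one_mul]
    _ ≤ _ := by
        gcongr

/-- A piecewise constant approximation of a `C¹` function by averages over balls of radius `h`. -/
theorem lintegral_sub_average_sq_le {f : E → ℝ} (hf : ContDiff ℝ 1 f) {h : ℝ} (hh : 0 < h)
    {s : Set E} (hs : MeasurableSet s) {c : E → E} (hc : ∀ x ∈ s, dist x (c x) < h) :
    ∫⁻ x in s, ‖f x - ⨍ y in Metric.ball (c x) h, f y ∂μ‖ₑ ^ 2 ∂μ
      ≤ ENNReal.ofReal (2 ^ Module.finrank ℝ E) * ENNReal.ofReal (2 * h) ^ 2
        * ∫⁻ x, ‖fderiv ℝ f x‖ₑ ^ 2 ∂μ := by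
  have hB0 : μ (Metric.ball 0 h) ≠ 0 := (Metric.measure_ball_pos μ 0 hh).ne'
  have hBt : μ (Metric.ball 0 h) ≠ ∞ := measure_ball_lt_top.ne
  have hcont : Continuous fun p : E × E => ‖f (p.1 + p.2) - f p.1‖ₑ := by
    have := hf.continuous
    exact ((this.comp (by fun_prop)).sub (this.comp (by fun_prop))).enorm
  set I := ∫⁻ x, ‖fderiv ℝ f x‖ₑ ^ 2 ∂μ
  calc ∫⁻ x in s, ‖f x - ⨍ y in Metric.ball (c x) h, f y ∂μ‖ₑ ^ 2 ∂μ
      ≤ ∫⁻ x in s, (μ (Metric.ball 0 h))⁻¹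
          * ∫⁻ z in Metric.ball 0 (2 * h), ‖f (x + z) - f x‖ₑ ^ 2 ∂μ ∂μ :=
        setLIntegral_mono' hs fun x hx => enorm_sub_average_sq_le μ hf.continuous hh (hc x hx)
    _ ≤ ∫⁻ x, (μ (Metric.ball 0 h))⁻¹
          * ∫⁻ z in Metric.ball 0 (2 * h), ‖f (x + z) - f x‖ₑ ^ 2 ∂μ ∂μ :=
        setLIntegral_le_lintegral _ _
    _ = (μ (Metric.ball 0 h))⁻¹
          * ∫⁻ z in Metric.ball 0 (2 * h), ∫⁻ x, ‖f (x + z) - f x‖ₑ ^ 2 ∂μ ∂μ := by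
        rw [lintegral_const_mul' _ _ (by simp [hB0]), lintegral_lintegral_swap]
        exact (hcont.measurable.pow_const 2).aemeasurable
    _ ≤ (μ (Metric.ball 0 h))⁻¹
          * ∫⁻ _ in Metric.ball (0 : E) (2 * h), ENNReal.ofReal (2 * h) ^ 2 * I ∂μ := by
        gcongr _ * ?_
        refine setLIntegral_mono' Metric.isOpen_ball.measurableSet fun z hz => ?_
        refine (lintegral_translate_sub_sq_le μ hf z).trans ?_
        gcongr
        rw [← ofReal_norm]
        exact ENNReal.ofReal_le_ofReal (mem_ball_zero_iff.1 hz).le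
    _ = _ := by
        -- Balls of radius `2h` and `h` have volume ratio `2 ^ finrank`; the volume of the smaller
        -- one cancels.
        rw [setLIntegral_const, Measure.addHaar_ball_mul_of_pos μ 0 two_pos]
        calc _ = (μ (Metric.ball 0 h))⁻¹ * μ (Metric.ball 0 h)
              * (ENNReal.ofReal (2 ^ Module.finrank ℝ E) * ENNReal.ofReal (2 * h) ^ 2 * I) :=
            by ring
          _ = _ := by rw [ENNReal.inv_mul_cancel hB0 hBt, one_mul]

/-- A `C¹` function supported in a bounded set is controlled by its gradient in `L²`. -/
theorem lintegral_sq_le_lintegral_fderiv_sq {f : E → ℝ} (hf : ContDiff ℝ 1 f) {s : Set E}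
    (hs : MeasurableSet s) (hfs : ∀ x ∉ s, f x = 0) {z : E} (hz : ∀ x ∈ s, x + z ∉ s) :
    ∫⁻ x in s, ‖f x‖ₑ ^ 2 ∂μ ≤ ‖z‖ₑ ^ 2 * ∫⁻ x, ‖fderiv ℝ f x‖ₑ ^ 2 ∂μ := by
  refine le_trans ?_ (lintegral_translate_sub_sq_le μ hf z)
  refine le_trans (setLIntegral_mono' hs fun x hx => ?_) (setLIntegral_le_lintegral s _)
  rw [hfs _ (hz x hx), zero_sub, enorm_neg]

theorem enorm_sq_eq_lintegral {α : Type*} [MeasurableSpace α] {ν : Measure α} (u : Lp ℝ 2 ν) :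
    ‖u‖ₑ ^ 2 = ∫⁻ x, ‖u x‖ₑ ^ 2 ∂ν := by
  rw [Lp.enorm_def, eLpNorm_eq_lintegral_rpow_enorm_toReal (by simp) (by simp),
    ← ENNReal.rpow_ofNat, ← ENNReal.rpow_mul]
  simp

/-- The functions that are constant on the fibres of a simple function, as elements of `L²`. -/
def fibrewiseConst {α : Type*} [MeasurableSpace α] (ν : Measure α) [IsFiniteMeasure ν]
    {ι : Type*} (g : SimpleFunc α ι) : (ι → ℝ) →ₗ[ℝ] Lp ℝ 2 ν where
  toFun a := ((g.map a).memLp_of_isFiniteMeasure 2 ν).toLp _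
  map_add' _ _ := rfl
  map_smul' _ _ := rfl

/-- Up to an error controlled by the gradient, `C¹` functions on a bounded set lie in a finite
dimensional subspace of `L²`. -/
theorem exists_finiteDimensional_approx {s : Set E} (hs : MeasurableSet s)
    (hb : Bornology.IsBounded s) {h : ℝ} (hh : 0 < h) :
    ∃ S : Submodule ℝ (Lp ℝ 2 (μ.restrict s)), FiniteDimensional ℝ S ∧
      ∀ f : E → ℝ, ContDiff ℝ 1 f → ∀ u : Lp ℝ 2 (μ.restrict s), u =ᵐ[μ.restrict s] f →
        ∃ v ∈ S, ‖u - v‖ₑ ^ 2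
          ≤ ENNReal.ofReal (2 ^ Module.finrank ℝ E) * ENNReal.ofReal (2 * h) ^ 2
            * ∫⁻ x, ‖fderiv ℝ f x‖ₑ ^ 2 ∂μ := by
  have : IsFiniteMeasure (μ.restrict s) := ⟨by simpa using hb.measure_lt_top⟩
  have htb : TotallyBounded s := hb.isCompact_closure.totallyBounded.subset subset_closure
  obtain ⟨t, htf, hst⟩ := Metric.totallyBounded_iff.1 htb h hh
  -- `SimpleFunc.nearestPtInd` needs the net as a sequence. The index `n` carries the extra point
  -- `0`; this is harmless, since one more candidate cannot increase the distance to the nearest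
  -- point.
  obtain ⟨e, N, he⟩ : ∃ (e : ℕ → E) (N : ℕ), ∀ y ∈ t, ∃ k ≤ N, e k = y := by
    obtain ⟨n, p, -, rfl⟩ := htf.fin_param
    refine ⟨fun k => if hk : k < n then p ⟨k, hk⟩ else 0, n, ?_⟩
    rintro _ ⟨k, rfl⟩
    exact ⟨k, k.2.le, by simp⟩
  let g : SimpleFunc E (Fin (N + 1)) := (SimpleFunc.nearestPtInd e N).map (Fin.ofNat (N + 1))
  have hg : ∀ x ∈ s, dist x (e (g x)) < h := by
    intro x hx
    obtain ⟨y, hy, hxy⟩ := Set.mem_iUnion₂.1 (hst hx)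
    obtain ⟨k, hk, rfl⟩ := he y hy
    have h1 := SimpleFunc.edist_nearestPt_le e x hk
    have h2 : ((g x : Fin (N + 1)) : ℕ) = SimpleFunc.nearestPtInd e N x :=
      Nat.mod_eq_of_lt (Nat.lt_succ_of_le (SimpleFunc.nearestPtInd_le e N x))
    rw [h2]
    simp only [SimpleFunc.nearestPt, SimpleFunc.coe_map, Function.comp_apply, edist_dist] at h1
    rw [ENNReal.ofReal_le_ofReal_iff dist_nonneg] at h1
    rw [dist_comm]
    refine h1.trans_lt ?_
    rwa [dist_comm]
  refine ⟨LinearMap.range (fibrewiseConst (μ.restrict s) g), inferInstance, fun f hf u hu => ?_⟩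
  refine ⟨_, ⟨fun i => ⨍ y in Metric.ball (e i) h, f y ∂μ, rfl⟩, ?_⟩
  rw [enorm_sq_eq_lintegral]
  refine le_trans (le_of_eq (lintegral_congr_ae ?_))
    (lintegral_sub_average_sq_le μ hf hh hs (c := fun x => e (g x)) hg)
  set a : Fin (N + 1) → ℝ := fun i => ⨍ y in Metric.ball (e i) h, f y ∂μ
  filter_upwards [hu, Lp.coeFn_sub u (fibrewiseConst (μ.restrict s) g a),
    ((g.map a).memLp_of_isFiniteMeasure 2 (μ.restrict s)).coeFn_toLp] with x h1 h2 h3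
  rw [h2, Pi.sub_apply, h1]
  congr 3

end Translation

/-! ### Maximisers of abstract Rayleigh quotients -/

section Rayleigh

open Filter Topology

variable {H : Type*} [NormedAddCommGroup H] [NormedSpace ℝ H]

/-- The values of the Rayleigh quotient of two bilinear forms. -/
def rayleighValues (b d : LinearMap.BilinForm ℝ H) : Set ℝ := {t | ∃ x, x ≠ 0 ∧ t = b x x / d x x}

variable {b d : LinearMap.BilinForm ℝ H}

theorem bddAbove_rayleighValues (hd : ∀ x, x ≠ 0 → 0 < d x x) {C : ℝ}
    (hC : ∀ x, b x x ≤ C * d x x) : BddAbove (rayleighValues b d) := by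
  refine ⟨C, ?_⟩
  rintro _ ⟨x, hx, rfl⟩
  rw [div_le_iff₀ (hd x hx)]
  exact hC x

theorem apply_self_le_sSup_mul (hd : ∀ x, x ≠ 0 → 0 < d x x)
    (hbdd : BddAbove (rayleighValues b d)) (x : H) :
    b x x ≤ sSup (rayleighValues b d) * d x x := by
  rcases eq_or_ne x 0 with rfl | hx
  · simp
  · rw [← div_le_iff₀ (hd x hx)]
    exact le_csSup hbdd ⟨x, hx, rfl⟩

/-- A positive supremum of a Rayleigh quotient is attained if the numerator is compact with respect
to the coercive denominator. -/
theorem exists_rayleigh_eq_sSup [CompleteSpace H]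
    (hbc : Continuous fun x => b x x) (hdc : Continuous fun x => d x x)
    {c : ℝ} (hc : 0 < c) (hcoer : ∀ x, c * ‖x‖ ^ 2 ≤ d x x)
    (hbdd : BddAbove (rayleighValues b d)) (hpos : 0 < sSup (rayleighValues b d))
    (hcpt : ∀ x : ℕ → H, (∀ n, d (x n) (x n) ≤ 1) → ∃ φ : ℕ → ℕ, StrictMono φ ∧
      ∀ ε > 0, ∃ N, ∀ m ≥ N, ∀ n ≥ N, b (x (φ m) - x (φ n)) (x (φ m) - x (φ n)) ≤ ε) :
    ∃ x, x ≠ 0 ∧ b x x / d x x = sSup (rayleighValues b d) := by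
  have hd : ∀ x, x ≠ 0 → 0 < d x x := fun x hx =>
    (mul_pos hc (pow_pos (norm_pos_iff.2 hx) 2)).trans_le (hcoer x)
  set M := sSup (rayleighValues b d) with hM
  have hle : ∀ x, b x x ≤ M * d x x := apply_self_le_sSup_mul hd hbdd
  -- The real `sSup` of the empty set is `0`, which a positive supremum excludes.
  have hne : (rayleighValues b d).Nonempty := by
    by_contra h
    rw [Set.not_nonempty_iff_eq_empty] at h
    rw [h, Real.sSup_empty] at hM
    exact hpos.ne' hM
  have hnorm : ∀ t ∈ rayleighValues b d, ∃ x, d x x = 1 ∧ b x x = t := by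
    rintro _ ⟨x, hx, rfl⟩
    have hp := hd x hx
    refine ⟨(Real.sqrt (d x x))⁻¹ • x, ?_, ?_⟩ <;>
    · simp only [map_smul, LinearMap.smul_apply, smul_eq_mul]
      rw [← mul_assoc, ← mul_inv, Real.mul_self_sqrt hp.le]
      field_simp
  obtain ⟨t, -, httend, htmem⟩ := exists_seq_tendsto_sSup hne hbdd
  choose x hx1 hxt using fun n => hnorm (t n) (htmem n)
  obtain ⟨φ, hφ, hφb⟩ := hcpt x fun n => (hx1 n).le
  have hlim : Tendsto (fun n => b (x (φ n)) (x (φ n))) atTop (𝓝 M) := by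
    simp_rw [hxt]
    exact httend.comp hφ.tendsto_atTop
  -- Parallelogram identity for the nonnegative form `M d - b`, with its value at `y + z` dropped.
  have hkey : ∀ y z, M * d (y - z) (y - z)
      ≤ 2 * (M * d y y) + 2 * (M * d z z) - 2 * b y y - 2 * b z z + b (y - z) (y - z) := by
    intro y z
    have := hle (y + z)
    simp only [map_add, map_sub, LinearMap.add_apply, LinearMap.sub_apply] at this ⊢
    linarith
  have hcauchy : CauchySeq fun n => x (φ n) := by
    rw [Metric.cauchySeq_iff]
    intro ε hε
    -- The right side of `hkey` will be below `5 δ`: each of the two defects `M - b` counts twice,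
    -- and the difference term once.
    have hδ : 0 < M * (c * ε ^ 2) / 10 := by positivity
    set δ := M * (c * ε ^ 2) / 10
    obtain ⟨N₁, hN₁⟩ := hφb δ hδ
    obtain ⟨N₂, hN₂⟩ := eventually_atTop.1 (hlim.eventually (lt_mem_nhds (sub_lt_self M hδ)))
    refine ⟨max N₁ N₂, fun m hm n hn => ?_⟩
    have h1 := hN₁ m (le_of_max_le_left hm) n (le_of_max_le_left hn)
    have h2 := hN₂ m (le_of_max_le_right hm)
    have h3 := hN₂ n (le_of_max_le_right hn)
    have h4 := hkey (x (φ m)) (x (φ n))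
    rw [hx1, hx1] at h4
    have h5 : M * (c * ‖x (φ m) - x (φ n)‖ ^ 2) < M * (c * ε ^ 2) := by
      have h6 := mul_le_mul_of_nonneg_left (hcoer (x (φ m) - x (φ n))) hpos.le
      have h7 : M * (c * ε ^ 2) = 10 * δ := by simp only [δ]; ring
      linarith
    rw [dist_eq_norm]
    have h8 := lt_of_mul_lt_mul_left (lt_of_mul_lt_mul_left h5 hpos.le) hc.le
    exact lt_of_pow_lt_pow_left₀ 2 hε.le h8
  obtain ⟨p, hp⟩ := cauchySeq_tendsto_of_complete hcauchy
  have hdp : d p p = 1 := by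
    refine tendsto_nhds_unique ((hdc.tendsto p).comp hp) ?_
    simp [Function.comp_def, hx1]
  have hbp : b p p = M := tendsto_nhds_unique ((hbc.tendsto p).comp hp) hlim
  refine ⟨p, ?_, by rw [hdp, hbp, div_one]⟩
  rintro rfl
  simp at hdp

/-- The Euler-Lagrange equation of a Rayleigh quotient at a maximizer. -/
theorem apply_eq_sSup_mul_of_rayleigh_eq (hb : b.IsSymm) (hs : d.IsSymm)
    (hd : ∀ x, x ≠ 0 → 0 < d x x) (hbdd : BddAbove (rayleighValues b d)) {p : H} (hp : p ≠ 0)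
    (hmax : b p p / d p p = sSup (rayleighValues b d)) (q : H) :
    b p q = sSup (rayleighValues b d) * d p q := by
  set M := sSup (rayleighValues b d)
  have hle : ∀ x, b x x ≤ M * d x x := apply_self_le_sSup_mul hd hbdd
  have h0 : b p p = M * d p p := by rw [← hmax, div_mul_cancel₀ _ (hd p hp).ne']
  have hbs : b q p = b p q := hb.eq q p
  have hds : d q p = d p q := hs.eq q p
  -- `M d - b` along the line `p + η q` is nonnegative and vanishes at `η = 0`. With zero constant
  -- term, a nonpositive discriminant forces the linear coefficient to vanish.
  have hquad : ∀ η : ℝ, 0 ≤ (M * d q q - b q q) * (η * η) + 2 * (M * d p q - b p q) * η + 0 := by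
    intro η
    have := hle (p + η • q)
    simp only [map_add, map_smul, LinearMap.add_apply, LinearMap.smul_apply, smul_eq_mul] at this
    rw [hbs, hds] at this
    linarith
  have := discrim_le_zero hquad
  rw [discrim] at this
  have h2 : (2 * (M * d p q - b p q)) ^ 2 = 0 := le_antisymm (by linarith) (sq_nonneg _)
  have h3 := pow_eq_zero_iff (two_ne_zero) |>.1 h2
  linarith

/-- A maximizer of a Rayleigh quotient is a critical point. -/
theorem hasDerivAt_rayleigh (hb : b.IsSymm) (hs : d.IsSymm)
    (hd : ∀ x, x ≠ 0 → 0 < d x x) (hbdd : BddAbove (rayleighValues b d)) {p : H} (hp : p ≠ 0)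
    (hmax : b p p / d p p = sSup (rayleighValues b d)) (q : H) :
    HasDerivAt (fun η : ℝ => b (p + η • q) (p + η • q) / d (p + η • q) (p + η • q)) 0 0 := by
  have hEL := apply_eq_sSup_mul_of_rayleigh_eq hb hs hd hbdd hp hmax q
  have h0 : b p p = sSup (rayleighValues b d) * d p p := by
    rw [← hmax, div_mul_cancel₀ _ (hd p hp).ne']
  have key : ∀ a : LinearMap.BilinForm ℝ H, a.IsSymm →
      HasDerivAt (fun η : ℝ => a (p + η • q) (p + η • q)) (2 * a p q) 0 := by
    intro a ha
    have hpoly : (fun η : ℝ => a (p + η • q) (p + η • q))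
        = fun η : ℝ => a p p + 2 * a p q * η + a q q * η ^ 2 := by
      funext η
      have has : a q p = a p q := ha.eq q p
      simp only [map_add, map_smul, LinearMap.add_apply, LinearMap.smul_apply, smul_eq_mul, has]
      ring
    rw [hpoly]
    have h1 := (((hasDerivAt_id (0 : ℝ)).const_mul (2 * a p q)).const_add (a p p)).add
      (((hasDerivAt_id (0 : ℝ)).pow 2).const_mul (a q q))
    exact h1.congr_deriv (by simp)
  have h := (key b hb).div (key d hs) (by simpa using (hd p hp).ne')
  refine h.congr_deriv ?_
  simp only [zero_smul, add_zero, hEL, h0]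
  ring

end Rayleigh

/-! ### Completeness, Poincaré inequality and Rellich theorem -/

section Sobolev

open Filter Topology

/-- An operator that is approximated on a subspace by finite rank projections maps bounded sequences
in the subspace to sequences with convergent subsequences. -/
theorem exists_tendsto_subseq_of_finiteDimensional_projection
    {G K : Type*} [NormedAddCommGroup G] [NormedSpace ℝ G] [NormedAddCommGroup K]
    [InnerProductSpace ℝ K] [CompleteSpace K] {T : G →L[ℝ] K} {W : Submodule ℝ G}
    (hT : ∀ ε : ℝ, 0 < ε → ∃ S : Submodule ℝ K, ∃ _ : FiniteDimensional ℝ S,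
      ∀ u ∈ W, ‖T u - S.starProjection (T u)‖ ≤ ε * ‖u‖)
    {u : ℕ → G} (hu : ∀ n, u n ∈ W) {R : ℝ} (hR : ∀ n, ‖u n‖ ≤ R) :
    ∃ a, ∃ φ : ℕ → ℕ, StrictMono φ ∧ Tendsto (fun n => T (u (φ n))) atTop (𝓝 a) := by
  have hcpt : IsCompactOperator (T.comp W.subtypeL) := by
    -- With `ε = 1 / (n + 1)` the projected operators are compact and converge in operator norm on
    -- `W`.
    choose S hS hle using fun n : ℕ => hT _ (Nat.one_div_pos_of_nat (α := ℝ) (n := n))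
    refine isCompactOperator_of_tendsto (l := atTop)
      (F := fun n => (S n).starProjection.comp (T.comp W.subtypeL)) ?_
      (Eventually.of_forall fun n => ?_)
    · rw [tendsto_iff_norm_sub_tendsto_zero]
      refine squeeze_zero (fun _ => norm_nonneg _) (fun n => ?_)
        (tendsto_one_div_add_atTop_nhds_zero_nat (𝕜 := ℝ))
      rw [norm_sub_rev]
      exact ContinuousLinearMap.opNorm_le_bound _ (by positivity) fun u => hle n u u.2
    · have hc : IsCompactOperator (S n).subtypeL := isCompactOperator_of_locallyCompactSpace_rng _
      exact hc.comp_clm ((S n).orthogonalProjectionOnto.comp (T.comp W.subtypeL))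
  obtain ⟨K, hK, hKs⟩ := IsCompactOperator.image_closedBall_subset_compact
    (f := (T.comp W.subtypeL : W →ₗ[ℝ] K)) hcpt R
  obtain ⟨a, -, φ, hφ, ha⟩ := hK.tendsto_subseq (x := fun n => T (u n)) fun n =>
    hKs ⟨⟨u n, hu n⟩, mem_closedBall_zero_iff.2 (hR n), rfl⟩
  exact ⟨a, φ, hφ, ha⟩

variable {Ω : Opens Plane}

/-- The map `val` as a continuous linear map. -/
def valL (Ω : Opens Plane) : W12 Ω →L[ℝ] L2 Ω :=
  (WithLp.fstL 2 ℝ (L2 Ω) (PiLp 2 fun _ : Fin 2 => L2 Ω)).comp (W12 Ω).subtypeL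

/-- The map `wderiv k` as a continuous linear map. -/
def wderivL (Ω : Opens Plane) (k : Fin 2) : W12 Ω →L[ℝ] L2 Ω :=
  (PiLp.proj 2 (fun _ : Fin 2 => L2 Ω) k).comp
    ((WithLp.sndL 2 ℝ (L2 Ω) (PiLp 2 fun _ : Fin 2 => L2 Ω)).comp (W12 Ω).subtypeL)

theorem val_eq (u : W12 Ω) : val u = valL Ω u := rfl

theorem wderiv_eq (k : Fin 2) (u : W12 Ω) : wderiv k u = wderivL Ω k u := rfl

theorem integral_mul_eq_inner (u : L2 Ω) {f : Plane → ℝ}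
    (hf : MemLp f 2 (volume.restrict (Ω : Set Plane))) :
    ∫ x in (Ω : Set Plane), u x * f x = inner ℝ (hf.toLp f) u := by
  rw [L2.inner_def]
  refine integral_congr_ae ?_
  filter_upwards [hf.coeFn_toLp] with x hx
  simp [hx]

theorem l2_eq_inner (u v : L2 Ω) : l2 Ω u v = inner ℝ u v := by
  rw [L2.inner_def]
  simp [l2, mul_comm]

theorem dirichlet_eq (u v : W12 Ω) :
    dirichlet u v = ∑ k, inner ℝ (wderivL Ω k u) (wderivL Ω k v) :=
  Finset.sum_congr rfl fun _ _ => l2_eq_inner _ _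

theorem dirichlet_self_eq (u : W12 Ω) : dirichlet u u = ∑ k, ‖wderivL Ω k u‖ ^ 2 := by
  simp [dirichlet_eq]

theorem dirichlet_self_nonneg (u : W12 Ω) : 0 ≤ dirichlet u u := by
  rw [dirichlet_self_eq]
  positivity

theorem continuous_dirichlet_self : Continuous fun u : W12 Ω => dirichlet u u := by
  simp_rw [dirichlet_self_eq]
  fun_prop

theorem norm_sq_eq (u : W12 Ω) : ‖u‖ ^ 2 = ‖valL Ω u‖ ^ 2 + dirichlet u u := by
  rw [dirichlet_self_eq]
  change ‖(u : WithLp 2 (L2 Ω × PiLp 2 (fun _ : Fin 2 => L2 Ω)))‖ ^ 2 = _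
  rw [WithLp.prod_norm_sq_eq_of_L2, PiLp.norm_sq_eq_of_L2]
  rfl

/-- Each test function imposes an equality of two continuous linear functionals. Completeness of the
Sobolev spaces follows. -/
theorem isClosed_W12 (Ω : Opens Plane) :
    IsClosed (W12 Ω : Set (WithLp 2 (L2 Ω × PiLp 2 (fun _ : Fin 2 => L2 Ω)))) := by
  have h : (W12 Ω : Set (WithLp 2 (L2 Ω × PiLp 2 (fun _ : Fin 2 => L2 Ω))))
      = ⋂ (k : Fin 2) (φ : 𝓓(Ω, ℝ)),
        {U | inner ℝ ((memLp_test_partial Ω k φ).toLp _) (WithLp.fstL 2 ℝ _ _ U)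
          = -inner ℝ ((memLp_test Ω φ).toLp _)
            (PiLp.proj (𝕜 := ℝ) 2 (fun _ : Fin 2 => L2 Ω) k (WithLp.sndL 2 ℝ _ _ U))} := by
    ext U
    simp only [Set.mem_iInter, Set.mem_ofPred_eq, ← integral_mul_eq_inner]
    rfl
  rw [h]
  refine isClosed_iInter fun k => isClosed_iInter fun φ => isClosed_eq ?_ ?_ <;> fun_prop

instance : CompleteSpace (W12 Ω) := (isClosed_W12 Ω).completeSpace_coe

instance : CompleteSpace (W12o Ω) :=
  (Submodule.isClosed_topologicalClosure (testScalar Ω)).completeSpace_coe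

instance : CompleteSpace (V Ω) :=
  (Submodule.isClosed_topologicalClosure (testSolenoidal Ω)).completeSpace_coe

theorem setIntegral_test_eq_integral (φ : 𝓓(Ω, ℝ)) {f : Plane → ℝ}
    (hf : ∀ x, φ x = 0 → f x = 0) : ∫ x in (Ω : Set Plane), f x = ∫ x, f x :=
  setIntegral_eq_integral_of_forall_compl_eq_zero fun x hx =>
    hf x (image_eq_zero_of_notMem_tsupport fun h => hx (φ.tsupport_subset h))

/-- Integration by parts for test functions. -/
theorem integral_test_mul_partial (φ ψ : 𝓓(Ω, ℝ)) (k : Fin 2) :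
    ∫ x in (Ω : Set Plane), φ x * fderiv ℝ ψ x (cart k)
      = -∫ x in (Ω : Set Plane), fderiv ℝ φ x (cart k) * ψ x := by
  have hcont : ∀ χ : 𝓓(Ω, ℝ), Continuous fun x => fderiv ℝ χ x (cart k) := fun χ =>
    (χ.contDiff.continuous_fderiv (by simp)).clm_apply continuous_const
  rw [setIntegral_test_eq_integral φ fun x hx => by rw [hx, zero_mul],
    setIntegral_test_eq_integral ψ fun x hx => by rw [hx, mul_zero]]
  refine integral_mul_fderiv_eq_neg_fderiv_mul_of_integrable ?_ ?_ ?_ ?_ ?_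
  · exact ((hcont φ).mul ψ.continuous).integrable_of_hasCompactSupport ψ.hasCompactSupport.mul_left
  · exact (φ.continuous.mul (hcont ψ)).integrable_of_hasCompactSupport φ.hasCompactSupport.mul_right
  · exact (φ.continuous.mul ψ.continuous).integrable_of_hasCompactSupport
      φ.hasCompactSupport.mul_right
  · exact fun x _ => φ.contDiff.differentiable (by simp) x
  · exact fun x _ => ψ.contDiff.differentiable (by simp) x

/-- The weak derivatives of a test function are the classical ones. -/
theorem wderiv_ae_eq {u : W12 Ω} {φ : 𝓓(Ω, ℝ)} (hu : val u =ᵐ[volume.restrict (Ω : Set Plane)] φ)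
    (k : Fin 2) :
    wderiv k u =ᵐ[volume.restrict (Ω : Set Plane)] fun x => fderiv ℝ φ x (cart k) := by
  have hmem : MemLp (fun x => wderiv k u x - fderiv ℝ φ x (cart k)) 2
      (volume.restrict (Ω : Set Plane)) := (Lp.memLp _).sub (memLp_test_partial Ω k φ)
  -- Uniqueness of weak derivatives: the difference is orthogonal to every test function.
  have hz := Ω.isOpen.ae_eq_zero_of_integral_contDiff_smul_eq_zero
    (μ := volume.restrict (Ω : Set Plane))
    ((hmem.locallyIntegrable (by norm_num)).locallyIntegrableOn _) ?_
  · filter_upwards [hz, ae_restrict_mem Ω.isOpen.measurableSet] with x h1 h2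
    exact sub_eq_zero.1 (h1 h2)
  intro g hg hgc hgs
  let ψ : 𝓓(Ω, ℝ) := ⟨g, hg, hgc, hgs⟩
  have h1 := u.2 k ψ
  change ∫ x in (Ω : Set Plane), val u x * fderiv ℝ ψ x (cart k)
    = -∫ x in (Ω : Set Plane), wderiv k u x * ψ x at h1
  have h2 : ∫ x in (Ω : Set Plane), val u x * fderiv ℝ ψ x (cart k)
      = ∫ x in (Ω : Set Plane), φ x * fderiv ℝ ψ x (cart k) := by
    refine integral_congr_ae ?_
    filter_upwards [hu] with x hx
    rw [hx]
  rw [h2, integral_test_mul_partial, neg_inj] at h1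
  have h3 : ∀ x, g x • (wderiv k u x - fderiv ℝ φ x (cart k))
      = wderiv k u x * ψ x - fderiv ℝ φ x (cart k) * ψ x := by
    intro x
    change g x * _ = _ * g x - _ * g x
    ring
  simp_rw [h3]
  have h4 : Integrable (fun x => fderiv ℝ φ x (cart k) * ψ x) (volume.restrict (Ω : Set Plane)) :=
    (memLp_test_partial Ω k φ).integrable_mul (memLp_test Ω ψ)
  rw [integral_sub (integrable_mul_test Ω _ (memLp_test Ω ψ)) h4, h1, sub_self]

theorem sum_smul_cart (x : Plane) : x = ∑ k, x k • cart k := by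
  ext i
  fin_cases i <;> simp [cart]

theorem norm_sq_le_sum_apply_cart (T : Plane →L[ℝ] ℝ) : ‖T‖ ^ 2 ≤ ∑ k, T (cart k) ^ 2 := by
  have h0 : 0 ≤ ∑ k, T (cart k) ^ 2 := by positivity
  rw [← Real.le_sqrt (norm_nonneg _) h0]
  refine T.opNorm_le_bound (Real.sqrt_nonneg _) fun x => ?_
  have hx : T x = ∑ k, T (cart k) * x k := by
    conv_lhs => rw [sum_smul_cart x]
    simp [mul_comm]
  rw [EuclideanSpace.norm_eq, ← Real.sqrt_mul h0]
  refine Real.abs_le_sqrt ?_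
  simp only [hx, Real.norm_eq_abs, sq_abs]
  exact Finset.sum_mul_sq_le_sq_mul_sq _ _ _

/-- Passes from the classical gradient on the whole plane, used in the translation estimates, to
weak derivatives on `Ω`. The support lies in `Ω`, and the operator norm is at most the Euclidean
norm of the partial derivatives. -/
theorem lintegral_fderiv_sq_le {u : W12 Ω} {φ : 𝓓(Ω, ℝ)}
    (hu : val u =ᵐ[volume.restrict (Ω : Set Plane)] φ) :
    ∫⁻ x, ‖fderiv ℝ φ x‖ₑ ^ 2 ≤ ENNReal.ofReal (dirichlet u u) := by
  have hsupp : ∫⁻ x, ‖fderiv ℝ φ x‖ₑ ^ 2 = ∫⁻ x in (Ω : Set Plane), ‖fderiv ℝ φ x‖ₑ ^ 2 := by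
    symm
    refine setLIntegral_eq_of_support_subset fun x hx => ?_
    refine φ.tsupport_subset (support_fderiv_subset ℝ fun h => hx ?_)
    simp only [← ofReal_norm, h]
    simp
  have hm : ∀ k, Measurable fun x => ‖fderiv ℝ φ x (cart k)‖ₑ ^ 2 := fun k =>
    ((φ.contDiff.continuous_fderiv (by simp)).clm_apply
      continuous_const).enorm.measurable.pow_const 2
  have hD : ENNReal.ofReal (dirichlet u u)
      = ∫⁻ x in (Ω : Set Plane), ∑ k, ‖fderiv ℝ φ x (cart k)‖ₑ ^ 2 := by
    rw [dirichlet_self_eq, ENNReal.ofReal_sum_of_nonneg fun _ _ => by positivity,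
      lintegral_finsetSum _ fun k _ => hm k]
    refine Finset.sum_congr rfl fun k _ => ?_
    rw [ENNReal.ofReal_pow (norm_nonneg _), ofReal_norm, enorm_sq_eq_lintegral]
    refine lintegral_congr_ae ?_
    filter_upwards [wderiv_ae_eq hu k] with x hx
    rw [← wderiv_eq, hx]
  rw [hsupp, hD]
  refine lintegral_mono fun x => ?_
  have h := norm_sq_le_sum_apply_cart (fderiv ℝ φ x)
  have h' := ENNReal.ofReal_le_ofReal h
  rw [ENNReal.ofReal_sum_of_nonneg fun _ _ => by positivity, ENNReal.ofReal_pow (norm_nonneg _),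
    ofReal_norm] at h'
  refine h'.trans (le_of_eq (Finset.sum_congr rfl fun k _ => ?_))
  rw [← sq_abs, ENNReal.ofReal_pow (abs_nonneg _), ← Real.norm_eq_abs, ofReal_norm]

theorem norm_sq_le_of_enorm_sq_le {G : Type*} [NormedAddCommGroup G] {v : G} {a : ℝ} (ha : 0 ≤ a)
    (h : ‖v‖ₑ ^ 2 ≤ ENNReal.ofReal a) : ‖v‖ ^ 2 ≤ a := by
  rwa [← ofReal_norm, ← ENNReal.ofReal_pow (norm_nonneg _), ENNReal.ofReal_le_ofReal_iff ha] at h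

/-- The Poincaré inequality. -/
theorem exists_norm_sq_le_dirichlet (hb : Bornology.IsBounded (Ω : Set Plane)) :
    ∃ C, 0 ≤ C ∧ ∀ u ∈ W12o Ω, ‖valL Ω u‖ ^ 2 ≤ C * dirichlet u u := by
  obtain ⟨R, hR⟩ := hb.subset_ball (0 : Plane)
  -- Points of the open ball of radius `R` are less than `2R` apart, so this shift moves `Ω` off
  -- itself.
  set z : Plane := (2 * R) • cart 0 with hz
  have hzn : ‖z‖ = 2 * |R| := by simp [hz, norm_smul, cart]
  have hdisj : ∀ x ∈ (Ω : Set Plane), x + z ∉ (Ω : Set Plane) := by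
    intro x hx hxz
    have h1 := mem_ball_zero_iff.1 (hR hx)
    have h2 := mem_ball_zero_iff.1 (hR hxz)
    have h3 : ‖z‖ ≤ ‖x + z‖ + ‖x‖ := by simpa using norm_sub_le (x + z) x
    rw [hzn] at h3
    linarith [le_abs_self R]
  refine ⟨‖z‖ ^ 2, by positivity, fun u hu => ?_⟩
  have hcl : IsClosed {u : W12 Ω | ‖valL Ω u‖ ^ 2 ≤ ‖z‖ ^ 2 * dirichlet u u} :=
    isClosed_le (by fun_prop) (continuous_const.mul continuous_dirichlet_self)
  refine closure_minimal ?_ hcl hu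
  rintro v ⟨φ, hφ⟩
  refine norm_sq_le_of_enorm_sq_le (mul_nonneg (by positivity) (dirichlet_self_nonneg v)) ?_
  rw [enorm_sq_eq_lintegral, ENNReal.ofReal_mul (by positivity), ENNReal.ofReal_pow (norm_nonneg _),
    ofReal_norm]
  have hae : ∫⁻ x in (Ω : Set Plane), ‖valL Ω v x‖ₑ ^ 2 = ∫⁻ x in (Ω : Set Plane), ‖φ x‖ₑ ^ 2 := by
    refine lintegral_congr_ae ?_
    filter_upwards [hφ] with x hx
    rw [← val_eq, hx]
  rw [hae]
  refine (lintegral_sq_le_lintegral_fderiv_sq volume (φ.contDiff.of_le (by simp))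
    Ω.isOpen.measurableSet (fun x hx => ?_) hdisj).trans ?_
  · exact image_eq_zero_of_notMem_tsupport fun h => hx (φ.tsupport_subset h)
  · gcongr
    exact lintegral_fderiv_sq_le hφ

/-- Functions in `W12o Ω` with small gradient are close to a finite dimensional subspace. -/
theorem exists_finiteDimensional_projection (hb : Bornology.IsBounded (Ω : Set Plane)) {h : ℝ}
    (hh : 0 < h) :
    ∃ S : Submodule ℝ (L2 Ω), ∃ _ : FiniteDimensional ℝ S,
      ∀ u ∈ W12o Ω, ‖valL Ω u - S.starProjection (valL Ω u)‖ ^ 2 ≤ (4 * h) ^ 2 * dirichlet u u := by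
  obtain ⟨S, hS, hap⟩ := exists_finiteDimensional_approx volume Ω.isOpen.measurableSet hb hh
  refine ⟨S, hS, fun u hu => ?_⟩
  have hcl : IsClosed {u : W12 Ω | ‖valL Ω u - S.starProjection (valL Ω u)‖ ^ 2
      ≤ (4 * h) ^ 2 * dirichlet u u} :=
    isClosed_le (by fun_prop) (continuous_const.mul continuous_dirichlet_self)
  refine closure_minimal ?_ hcl hu
  rintro w ⟨φ, hφ⟩
  obtain ⟨v, hv, hle⟩ := hap φ (φ.contDiff.of_le (by simp)) (valL Ω w) hφ
  -- The projection is the best approximation in `S`. Unlike the choice of `v`, it depends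
  -- continuously on the function, so the estimate defines a closed set.
  have hmin : ‖valL Ω w - S.starProjection (valL Ω w)‖ ≤ ‖valL Ω w - v‖ := by
    rw [Submodule.starProjection_minimal]
    exact ciInf_le ⟨0, by rintro _ ⟨x, rfl⟩; exact norm_nonneg _⟩ (⟨v, hv⟩ : S)
  refine (pow_le_pow_left₀ (norm_nonneg _) hmin 2).trans ?_
  refine norm_sq_le_of_enorm_sq_le (mul_nonneg (by positivity) (dirichlet_self_nonneg w)) ?_
  refine hle.trans ?_
  -- In dimension two, `2² (2h)² = (4h)²`.
  have hcst : ENNReal.ofReal (2 ^ Module.finrank ℝ Plane) * ENNReal.ofReal (2 * h) ^ 2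
      = ENNReal.ofReal ((4 * h) ^ 2) := by
    rw [← ENNReal.ofReal_pow (by positivity), ← ENNReal.ofReal_mul (by positivity),
      finrank_euclideanSpace_fin]
    congr 1
    ring
  rw [hcst, ENNReal.ofReal_mul (by positivity)]
  gcongr
  exact lintegral_fderiv_sq_le hφ

/-- Rellich's theorem: bounded sequences in `W12o Ω` have subsequences converging in `L²`, for
bounded `Ω`. -/
theorem exists_tendsto_subseq (hb : Bornology.IsBounded (Ω : Set Plane)) {u : ℕ → W12 Ω}
    (hu : ∀ n, u n ∈ W12o Ω) {R : ℝ} (hR : ∀ n, ‖u n‖ ≤ R) :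
    ∃ a, ∃ φ : ℕ → ℕ, StrictMono φ ∧ Tendsto (fun n => valL Ω (u (φ n))) atTop (𝓝 a) := by
  refine exists_tendsto_subseq_of_finiteDimensional_projection (W := W12o Ω)
    (fun ε hε => ?_) hu hR
  obtain ⟨S, hS, hle⟩ := exists_finiteDimensional_projection hb (h := ε / 4) (by positivity)
  refine ⟨S, hS, fun v hv => le_of_sq_le_sq ((hle v hv).trans ?_) (by positivity)⟩
  rw [mul_div_cancel₀ ε (by norm_num : (4 : ℝ) ≠ 0), mul_pow]
  gcongr
  linarith [norm_sq_eq v, sq_nonneg ‖valL Ω v‖]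

end Sobolev

/-! ### The buoyancy form through bounded operators on `L²` -/

section Forms

open Filter Topology

variable {Ω : Opens Plane} {A : ℝ}

theorem isBounded_annulus (A : ℝ) : Bornology.IsBounded (annulus A : Set Plane) :=
  Metric.isBounded_ball.subset fun _ hx => mem_ball_zero_iff.2 hx.2

/-- The components of a field in `V` vanish on the boundary. -/
theorem apply_mem_W12o {w : W12vec Ω} (hw : w ∈ V Ω) (j : Fin 2) : w j ∈ W12o Ω := by
  have hc : Continuous fun w : W12vec Ω => w j :=
    (PiLp.proj (𝕜 := ℝ) 2 (fun _ : Fin 2 => W12 Ω) j).continuous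
  refine map_mem_closure (f := fun w : W12vec Ω => w j) (t := (testScalar Ω : Set (W12 Ω))) hc hw ?_
  rintro v ⟨φ, -, hφ⟩
  have hsub : Function.support (fun x => φ x j) ⊆ Function.support φ :=
    fun x hx h => hx (by simp [h])
  refine ⟨⟨fun x => φ x j, ?_, φ.hasCompactSupport.mono hsub,
    (closure_mono hsub).trans φ.tsupport_subset⟩, hφ j⟩
  exact (EuclideanSpace.proj (𝕜 := ℝ) j : Plane →L[ℝ] ℝ).contDiff.comp φ.contDiff

/-- The annulus stays away from the origin: `|x_j| ≤ r` and `r > A / 2`. -/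
theorem memLp_radialMultiplier (hA : 0 < A) (j : Fin 2) :
    MemLp (fun x : Plane => x j / ‖x‖ / ‖x‖) ∞ (volume.restrict (annulus A : Set Plane)) := by
  refine memLp_top_of_bound ?_ (1 / (A / 2)) ?_
  · have h1 : Measurable fun x : Plane => x j :=
      (EuclideanSpace.proj (𝕜 := ℝ) j : Plane →L[ℝ] ℝ).continuous.measurable
    exact ((h1.div measurable_norm).div measurable_norm).aestronglyMeasurable
  · filter_upwards [ae_restrict_mem (annulus A).isOpen.measurableSet] with x hx
    have hx' : A / 2 < ‖x‖ := hx.1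
    have hpos : 0 < ‖x‖ := lt_trans (by positivity) hx'
    rw [norm_div, norm_div, norm_norm]
    gcongr
    rw [div_le_one hpos]
    exact PiLp.norm_apply_le x j

/-- Multiplication by `x_j / r²` on `L²` of the annulus. -/
def radialMultiplier (hA : 0 < A) (j : Fin 2) : L2 (annulus A) →L[ℝ] L2 (annulus A) :=
  (ContinuousLinearMap.mul ℝ ℝ).holderL (volume.restrict (annulus A : Set Plane)) ∞ 2 2
    ((memLp_radialMultiplier hA j).toLp _)

theorem radialMultiplier_ae_eq (hA : 0 < A) (j : Fin 2) (u : L2 (annulus A)) :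
    radialMultiplier hA j u =ᵐ[volume.restrict (annulus A : Set Plane)]
      fun x => u x * (x j / ‖x‖ / ‖x‖) := by
  filter_upwards [(ContinuousLinearMap.mul ℝ ℝ).coeFn_holder (r := 2)
    ((memLp_radialMultiplier hA j).toLp _) u, (memLp_radialMultiplier hA j).coeFn_toLp] with x h1 h2
  change ((ContinuousLinearMap.mul ℝ ℝ).holder 2 ((memLp_radialMultiplier hA j).toLp _) u) x = _
  rw [h1, h2]
  simp [mul_comm]

/-- The buoyancy form in terms of inner products of `L²`. -/
theorem buoyancy_eq (hA : 0 < A) (w : W12vec (annulus A)) (θ : W12 (annulus A)) :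
    buoyancy A w θ = inner ℝ (valL (annulus A) θ) (valL (annulus A) (w 1))
      + 1 / geomB A * ∑ j, inner ℝ (valL (annulus A) θ)
        (radialMultiplier hA j (valL (annulus A) (w j))) := by
  have h1 : l2 (annulus A) (val θ) (vertical w)
      = inner ℝ (valL (annulus A) θ) (valL (annulus A) (w 1)) := l2_eq_inner _ _
  have h2 : l2 (annulus A) (val θ) (fun x => radial w x / ‖x‖)
      = ∑ j, inner ℝ (valL (annulus A) θ) (radialMultiplier hA j (valL (annulus A) (w j))) := by
    rw [← inner_sum, ← l2_eq_inner]
    refine integral_congr_ae ?_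
    filter_upwards [radialMultiplier_ae_eq hA 0 (valL (annulus A) (w 0)),
      radialMultiplier_ae_eq hA 1 (valL (annulus A) (w 1)),
      Lp.coeFn_add (radialMultiplier hA 0 (valL (annulus A) (w 0)))
        (radialMultiplier hA 1 (valL (annulus A) (w 1)))] with x h0 h1 h2
    rw [Fin.sum_univ_two, h2, Pi.add_apply, h0, h1, radial, Fin.sum_univ_two]
    simp only [val_eq]
    ring
  rw [buoyancy, h1, h2]

end Forms

/-! ### Coercivity and compactness for the coupled problem -/

section CoupledForms

open Filter Topology

/-- The bilinear form `(p, q) ↦ ⟪S p, T q⟫`. -/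
def innerForm {H K : Type*} [AddCommGroup H] [Module ℝ H] [NormedAddCommGroup K]
    [InnerProductSpace ℝ K] (S T : H →ₗ[ℝ] K) : LinearMap.BilinForm ℝ H :=
  LinearMap.mk₂ ℝ (fun p q => inner ℝ (S p) (T q))
    (fun p p' q => by rw [map_add, inner_add_left])
    (fun c p q => by rw [map_smul, real_inner_smul_left, smul_eq_mul])
    (fun p q q' => by rw [map_add, inner_add_right])
    (fun c p q => by rw [map_smul, real_inner_smul_right, smul_eq_mul])

variable {W K : Type*} [NormedAddCommGroup W] [NormedSpace ℝ W]
  [NormedAddCommGroup K] [InnerProductSpace ℝ K]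
  (ι : W →L[ℝ] K) (d : Fin 2 → W →L[ℝ] K) (m : Fin 2 → K →L[ℝ] K) (β : ℝ)
  (S : Submodule ℝ (PiLp 2 fun _ : Fin 2 => W)) (S₀ : Submodule ℝ W)

/-- The `j`-th component of the first entry of a pair. -/
def componentL (j : Fin 2) : S × S₀ →L[ℝ] W :=
  (PiLp.proj 2 (fun _ : Fin 2 => W) j).comp (S.subtypeL.comp (ContinuousLinearMap.fst ℝ S S₀))

/-- The second entry of a pair. -/
def scalarL : S × S₀ →L[ℝ] W := S₀.subtypeL.comp (ContinuousLinearMap.snd ℝ S S₀)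

/-- The operator `(w, θ) ↦ ι w₁ + β ∑ j, m_j ι w_j`. -/
def couplingL : S × S₀ →L[ℝ] K :=
  ι.comp (componentL S S₀ 1) + β • ∑ j, (m j).comp (ι.comp (componentL S S₀ j))

/-- The symmetric bilinear form of the coupling `(w, θ) ↦ ⟪ι θ, ι w₁ + β ∑ j, m_j ι w_j⟫`. -/
def couplingForm : LinearMap.BilinForm ℝ (S × S₀) :=
  (1 / 2 : ℝ) • (innerForm (ι.comp (scalarL S S₀)).toLinearMap (couplingL ι m β S S₀).toLinearMap
    + innerForm (couplingL ι m β S S₀).toLinearMap (ι.comp (scalarL S S₀)).toLinearMap)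

/-- The symmetric bilinear form of the Dirichlet integrals. -/
def dirichletForm : LinearMap.BilinForm ℝ (S × S₀) :=
  (∑ j, ∑ k, innerForm ((d k).comp (componentL S S₀ j)).toLinearMap
      ((d k).comp (componentL S S₀ j)).toLinearMap)
    + ∑ k, innerForm ((d k).comp (scalarL S S₀)).toLinearMap ((d k).comp (scalarL S S₀)).toLinearMap

variable {S S₀}

theorem inner_couplingL (p : S × S₀) (θ : W) :
    inner ℝ (ι θ) (couplingL ι m β S S₀ p) = inner ℝ (ι θ) (ι ((p.1 : PiLp 2 fun _ : Fin 2 => W) 1))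
      + β * ∑ j, inner ℝ (ι θ) (m j (ι ((p.1 : PiLp 2 fun _ : Fin 2 => W) j))) := by
  simp [couplingL, inner_add_right, real_inner_smul_right, componentL]
  ring

theorem couplingForm_apply (p q : S × S₀) :
    couplingForm ι m β S S₀ p q = 1 / 2 * (inner ℝ (ι p.2) (couplingL ι m β S S₀ q)
      + inner ℝ (ι q.2) (couplingL ι m β S S₀ p)) := by
  rw [real_inner_comm (couplingL ι m β S S₀ p)]
  rfl

theorem couplingForm_self (p : S × S₀) :
    couplingForm ι m β S S₀ p p = inner ℝ (ι p.2) (couplingL ι m β S S₀ p) := by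
  rw [couplingForm_apply]
  ring

theorem dirichletForm_apply (p q : S × S₀) :
    dirichletForm d S S₀ p q
      = (∑ j, ∑ k, inner ℝ (d k ((p.1 : PiLp 2 fun _ : Fin 2 => W) j))
          (d k ((q.1 : PiLp 2 fun _ : Fin 2 => W) j)))
        + ∑ k, inner ℝ (d k p.2) (d k q.2) := by
  simp only [dirichletForm, LinearMap.add_apply, LinearMap.sum_apply]
  rfl

theorem dirichletForm_self (p : S × S₀) :
    dirichletForm d S S₀ p p
      = (∑ j, ∑ k, ‖d k ((p.1 : PiLp 2 fun _ : Fin 2 => W) j)‖ ^ 2) + ∑ k, ‖d k p.2‖ ^ 2 := by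
  simp only [dirichletForm_apply, real_inner_self_eq_norm_sq]

theorem couplingForm_isSymm : (couplingForm ι m β S S₀).IsSymm :=
  ⟨fun p q => by rw [couplingForm_apply, couplingForm_apply, add_comm]⟩

theorem dirichletForm_isSymm : (dirichletForm d S S₀).IsSymm :=
  ⟨fun p q => by simp only [dirichletForm_apply, real_inner_comm]⟩

theorem continuous_couplingForm_self :
    Continuous fun p : S × S₀ => couplingForm ι m β S S₀ p p := by
  simp only [couplingForm_self]
  fun_prop

theorem continuous_dirichletForm_self :
    Continuous fun p : S × S₀ => dirichletForm d S S₀ p p := by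
  have hc : ∀ j, Continuous fun p : S × S₀ => (p.1 : PiLp 2 fun _ : Fin 2 => W) j := fun j =>
    (componentL S S₀ j).continuous
  simp only [dirichletForm_self]
  fun_prop

variable {d}

/-- The Poincaré bound applies to every component. The product carries the sup norm, so one of the
two entries gives `‖p‖`. -/
theorem dirichletForm_coercive {c : ℝ}
    (hP : ∀ u ∈ S₀, c * ‖u‖ ^ 2 ≤ ∑ k, ‖d k u‖ ^ 2) (hS : ∀ w ∈ S, ∀ j, w j ∈ S₀) (hc : 0 ≤ c)
    (p : S × S₀) : c * ‖p‖ ^ 2 ≤ dirichletForm d S S₀ p p := by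
  rw [dirichletForm_self]
  have h2 : c * ‖p.2‖ ^ 2 ≤ ∑ k, ‖d k p.2‖ ^ 2 := hP p.2 p.2.2
  have h1 : c * ‖p.1‖ ^ 2 ≤ ∑ j, ∑ k, ‖d k ((p.1 : PiLp 2 fun _ : Fin 2 => W) j)‖ ^ 2 := by
    rw [Submodule.coe_norm, PiLp.norm_sq_eq_of_L2, Finset.mul_sum]
    exact Finset.sum_le_sum fun j _ => hP _ (hS _ p.1.2 j)
  have h3 := mul_nonneg hc (sq_nonneg ‖p.1‖)
  have h4 := mul_nonneg hc (sq_nonneg ‖p.2‖)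
  rcases le_total ‖p.1‖ ‖p.2‖ with h | h
  · rw [Prod.norm_def, max_eq_right h]
    linarith
  · rw [Prod.norm_def, max_eq_left h]
    linarith

/-- Keeping the factor `‖ι p.2‖` lets compactness be used for the scalar entry only; the other
factor merely has to stay bounded. -/
theorem couplingForm_self_le (p : S × S₀) :
    couplingForm ι m β S S₀ p p ≤ ‖couplingL ι m β S S₀‖ * (‖ι p.2‖ * ‖p‖) := by
  rw [couplingForm_self]
  calc _ ≤ ‖ι p.2‖ * ‖couplingL ι m β S S₀ p‖ := real_inner_le_norm _ _
    _ ≤ ‖ι p.2‖ * (‖couplingL ι m β S S₀‖ * ‖p‖) := by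
      gcongr
      exact (couplingL ι m β S S₀).le_opNorm p
    _ = _ := by ring

theorem exists_couplingForm_le {c : ℝ} (hc : 0 < c)
    (hcoer : ∀ p : S × S₀, c * ‖p‖ ^ 2 ≤ dirichletForm d S S₀ p p) :
    ∃ C : ℝ, ∀ p : S × S₀, couplingForm ι m β S S₀ p p ≤ C * dirichletForm d S S₀ p p := by
  refine ⟨‖couplingL ι m β S S₀‖ * ‖ι‖ * c⁻¹, fun p => (couplingForm_self_le ι m β p).trans ?_⟩
  have h1 : ‖ι p.2‖ ≤ ‖ι‖ * ‖p‖ := (ι.le_opNorm _).trans (by gcongr; exact norm_snd_le p)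
  calc _ ≤ ‖couplingL ι m β S S₀‖ * (‖ι‖ * ‖p‖ * ‖p‖) := by gcongr
    _ = ‖couplingL ι m β S S₀‖ * ‖ι‖ * c⁻¹ * (c * ‖p‖ ^ 2) := by field_simp
    _ ≤ _ := by
      gcongr
      exact hcoer p

/-- Compactness of the coupling form, from compactness of `ι` on `S₀`. -/
theorem exists_subseq_couplingForm_sub_le {c : ℝ} (hc : 0 < c)
    (hcoer : ∀ p : S × S₀, c * ‖p‖ ^ 2 ≤ dirichletForm d S S₀ p p)
    (hι : ∀ u : ℕ → W, (∀ n, u n ∈ S₀) → ∀ R : ℝ, (∀ n, ‖u n‖ ≤ R) →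
      ∃ a, ∃ φ : ℕ → ℕ, StrictMono φ ∧ Tendsto (fun n => ι (u (φ n))) atTop (𝓝 a))
    (x : ℕ → S × S₀) (hx : ∀ n, dirichletForm d S S₀ (x n) (x n) ≤ 1) :
    ∃ φ : ℕ → ℕ, StrictMono φ ∧ ∀ ε > 0, ∃ N, ∀ k ≥ N, ∀ n ≥ N,
      couplingForm ι m β S S₀ (x (φ k) - x (φ n)) (x (φ k) - x (φ n)) ≤ ε := by
  have hbound : ∀ n, ‖x n‖ ≤ Real.sqrt c⁻¹ := fun n => by
    refine Real.le_sqrt_of_sq_le ?_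
    rw [← mul_one c⁻¹, le_inv_mul_iff₀ hc]
    exact (hcoer _).trans (hx n)
  set R := Real.sqrt c⁻¹
  have hR : 0 ≤ R := Real.sqrt_nonneg _
  obtain ⟨a, φ, hφ, ha⟩ := hι (fun n => (x n).2) (fun n => (x n).2.2) R
    fun n => (norm_snd_le (x n)).trans (hbound n)
  refine ⟨φ, hφ, fun ε hε => ?_⟩
  -- The summand `1` keeps `L` positive even if the operator vanishes.
  set L := ‖couplingL ι m β S S₀‖ * (2 * R) + 1
  have hL : 0 < L := by positivity
  obtain ⟨N, hN⟩ := Metric.cauchySeq_iff.1 ha.cauchySeq (ε / L) (by positivity)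
  refine ⟨N, fun k hk n hn => (couplingForm_self_le ι m β _).trans ?_⟩
  have h1 : ‖ι ((x (φ k) - x (φ n)).2 : S₀)‖ ≤ ε / L := by
    have h := (hN k hk n hn).le
    rw [dist_eq_norm, ← map_sub] at h
    exact h
  have h2 : ‖x (φ k) - x (φ n)‖ ≤ 2 * R := by
    refine (norm_sub_le _ _).trans ?_
    linarith [hbound (φ k), hbound (φ n)]
  calc _ ≤ ‖couplingL ι m β S S₀‖ * (ε / L * (2 * R)) := by gcongr
    _ = (‖couplingL ι m β S S₀‖ * (2 * R)) * (ε / L) := by ring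
    _ ≤ L * (ε / L) := by
      gcongr
      exact le_add_of_nonneg_right zero_le_one
    _ = ε := by field_simp

/-- The maximum of the quotient of a compact coupling form and a coercive Dirichlet form is
attained, and maximizers satisfy the Euler-Lagrange equations. -/
theorem coupled_rayleigh_quotient [CompleteSpace S] [CompleteSpace S₀]
    {B : (PiLp 2 fun _ : Fin 2 => W) → W → ℝ}
    (hB : ∀ w θ, B w θ = inner ℝ (ι θ) (ι (w 1)) + β * ∑ j, inner ℝ (ι θ) (m j (ι (w j))))
    {E : (PiLp 2 fun _ : Fin 2 => W) → (PiLp 2 fun _ : Fin 2 => W) → ℝ}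
    (hE : ∀ u v, E u v = ∑ j, ∑ k, inner ℝ (d k (u j)) (d k (v j)))
    {E₀ : W → W → ℝ} (hE₀ : ∀ u v, E₀ u v = ∑ k, inner ℝ (d k u) (d k v))
    {c : ℝ} (hc : 0 < c) (hP : ∀ u ∈ S₀, c * ‖u‖ ^ 2 ≤ E₀ u u) (hS : ∀ w ∈ S, ∀ j, w j ∈ S₀)
    (hι : ∀ u : ℕ → W, (∀ n, u n ∈ S₀) → ∀ R : ℝ, (∀ n, ‖u n‖ ≤ R) →
      ∃ a, ∃ φ : ℕ → ℕ, StrictMono φ ∧ Tendsto (fun n => ι (u (φ n))) atTop (𝓝 a))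
    (hpos : ∃ w ∈ S, ∃ θ ∈ S₀, 0 < B w θ)
    {Q : Set ℝ}
    (hQ : Q = {t | ∃ p : S × S₀, p ≠ 0 ∧ t = B p.1 p.2 / (E p.1 p.1 + E₀ p.2 p.2)}) :
    BddAbove Q ∧ 0 < sSup Q ∧
    (∃ p : S × S₀, p ≠ 0 ∧ B p.1 p.2 / (E p.1 p.1 + E₀ p.2 p.2) = sSup Q) ∧
    ∀ p : S × S₀, p ≠ 0 → B p.1 p.2 / (E p.1 p.1 + E₀ p.2 p.2) = sSup Q →
      (∀ q : S × S₀, B p.1 q.2 + B q.1 p.2 = 2 * sSup Q * (E q.1 p.1 + E₀ p.2 q.2)) ∧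
      ∀ q : S × S₀, HasDerivAt (fun η : ℝ => B (p + η • q).1 (p + η • q).2 /
        (E (p + η • q).1 (p + η • q).1 + E₀ (p + η • q).2 (p + η • q).2)) 0 0 := by
  have hBp : ∀ p q : S × S₀, B p.1 q.2 = inner ℝ (ι q.2) (couplingL ι m β S S₀ p) := fun p q => by
    rw [hB, inner_couplingL]
  have hF : ∀ p : S × S₀, B p.1 p.2 = couplingForm ι m β S S₀ p p := fun p => by
    rw [couplingForm_self, hBp]
  have hD : ∀ p : S × S₀, E p.1 p.1 + E₀ p.2 p.2 = dirichletForm d S S₀ p p := fun p => by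
    rw [dirichletForm_apply, hE, hE₀]
  have hQ' : Q = rayleighValues (couplingForm ι m β S S₀) (dirichletForm d S S₀) := by
    simp only [hQ, hF, hD, rayleighValues]
  have hcoer := dirichletForm_coercive (S := S) (fun u hu => by
    simpa [hE₀] using hP u hu) hS hc.le
  have hd : ∀ p : S × S₀, p ≠ 0 → 0 < dirichletForm d S S₀ p p := fun p hp =>
    (mul_pos hc (pow_pos (norm_pos_iff.2 hp) 2)).trans_le (hcoer p)
  obtain ⟨C, hC⟩ := exists_couplingForm_le ι m β hc hcoer
  have hbdd := bddAbove_rayleighValues hd hC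
  have hpos' : 0 < sSup (rayleighValues (couplingForm ι m β S S₀) (dirichletForm d S S₀)) := by
    obtain ⟨w, hw, θ, hθ, h⟩ := hpos
    have hp : 0 < couplingForm ι m β S S₀ (⟨w, hw⟩, ⟨θ, hθ⟩) (⟨w, hw⟩, ⟨θ, hθ⟩) := by
      rw [← hF]
      exact h
    have hne : ((⟨w, hw⟩, ⟨θ, hθ⟩) : S × S₀) ≠ 0 := fun h0 => by simp [h0] at hp
    exact (div_pos hp (hd _ hne)).trans_le (le_csSup hbdd ⟨_, hne, rfl⟩)
  simp only [hF, hD, hQ']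
  refine ⟨hbdd, hpos', ?_, fun p hp hmax => ⟨fun q => ?_, fun q => ?_⟩⟩
  · exact exists_rayleigh_eq_sSup (continuous_couplingForm_self ι m β)
      (continuous_dirichletForm_self d) hc hcoer hbdd hpos'
      (exists_subseq_couplingForm_sub_le ι m β hc hcoer hι)
  · have h := apply_eq_sSup_mul_of_rayleigh_eq (couplingForm_isSymm ι m β) (dirichletForm_isSymm d)
      hd hbdd hp hmax q
    -- `couplingForm` is half the sum of the two cross terms, whence the factor `2` in the
    -- multiplier.
    rw [couplingForm_apply, ← hBp, ← hBp, dirichletForm_apply, ← hE, ← hE₀] at h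
    have hsymm : E q.1 p.1 = E p.1 q.1 := by simp only [hE, real_inner_comm]
    rw [hsymm]
    linarith
  · exact hasDerivAt_rayleigh (couplingForm_isSymm ι m β) (dirichletForm_isSymm d)
      hd hbdd hp hmax q

end CoupledForms

/-! ### A pair with positive buoyancy -/

section Positivity

variable {Ω : Opens Plane}

theorem cart_apply (k j : Fin 2) : cart k j = if j = k then 1 else 0 := by
  simp [cart]

/-- Every test function represents an element of `W12 Ω`. -/
theorem exists_mem_testScalar (φ : 𝓓(Ω, ℝ)) :
    ∃ u : W12 Ω, val u =ᵐ[volume.restrict (Ω : Set Plane)] φ := by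
  refine ⟨⟨WithLp.toLp 2 ((memLp_test Ω φ).toLp _,
    WithLp.toLp 2 fun k => (memLp_test_partial Ω k φ).toLp _), fun k ψ => ?_⟩,
    (memLp_test Ω φ).coeFn_toLp⟩
  have h1 : ∫ x in (Ω : Set Plane), (memLp_test Ω φ).toLp _ x * fderiv ℝ ψ x (cart k)
      = ∫ x in (Ω : Set Plane), φ x * fderiv ℝ ψ x (cart k) := by
    refine integral_congr_ae ?_
    filter_upwards [(memLp_test Ω φ).coeFn_toLp] with x hx
    rw [hx]
  have h2 : ∫ x in (Ω : Set Plane), (memLp_test_partial Ω k φ).toLp _ x * ψ x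
      = ∫ x in (Ω : Set Plane), fderiv ℝ φ x (cart k) * ψ x := by
    refine integral_congr_ae ?_
    filter_upwards [(memLp_test_partial Ω k φ).coeFn_toLp] with x hx
    rw [hx]
  change ∫ x in (Ω : Set Plane), (memLp_test Ω φ).toLp _ x * fderiv ℝ ψ x (cart k)
    = -∫ x in (Ω : Set Plane), (memLp_test_partial Ω k φ).toLp _ x * ψ x
  rw [h1, h2, integral_test_mul_partial]

/-- The field `(-∂₁ψ, ∂₀ψ)` of a stream function `ψ`. -/
def streamField (ψ : Plane → ℝ) (x : Plane) : Plane :=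
  fderiv ℝ ψ x (cart 0) • cart 1 - fderiv ℝ ψ x (cart 1) • cart 0

theorem contDiff_fderiv_cart {ψ : Plane → ℝ} (hψ : ContDiff ℝ (⊤ : ℕ∞) ψ) (k : Fin 2) :
    ContDiff ℝ (⊤ : ℕ∞) fun x => fderiv ℝ ψ x (cart k) :=
  (hψ.fderiv_right (m := (⊤ : ℕ∞)) (by simp)).clm_apply contDiff_const

theorem contDiff_streamField {ψ : Plane → ℝ} (hψ : ContDiff ℝ (⊤ : ℕ∞) ψ) :
    ContDiff ℝ (⊤ : ℕ∞) (streamField ψ) :=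
  ((contDiff_fderiv_cart hψ 0).smul contDiff_const).sub
    ((contDiff_fderiv_cart hψ 1).smul contDiff_const)

theorem support_streamField_subset (ψ : Plane → ℝ) :
    Function.support (streamField ψ) ⊆ tsupport ψ := by
  intro x hx
  refine support_fderiv_subset ℝ fun h => hx ?_
  simp [streamField, h]

/-- The two mixed second derivatives cancel by symmetry. -/
theorem divergence_streamField {ψ : Plane → ℝ} (hψ : ContDiff ℝ (⊤ : ℕ∞) ψ) (x : Plane) :
    divergence (streamField ψ) x = 0 := by
  have hd : ∀ k, DifferentiableAt ℝ (fun x => fderiv ℝ ψ x (cart k)) x := fun k =>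
    (contDiff_fderiv_cart hψ k).differentiable (by simp) x
  have hdd : DifferentiableAt ℝ (fderiv ℝ ψ) x :=
    (hψ.fderiv_right (m := (⊤ : ℕ∞)) (by simp)).differentiable (by simp) x
  have h2 : ∀ k v, fderiv ℝ (fun x => fderiv ℝ ψ x (cart k)) x v
      = fderiv ℝ (fderiv ℝ ψ) x v (cart k) := fun k v => by
    rw [fderiv_clm_apply hdd (differentiableAt_const _)]
    simp
  have hsymm : IsSymmSndFDerivAt ℝ ψ x := hψ.contDiffAt.isSymmSndFDerivAt
    (by simpa using WithTop.coe_le_coe.2 (le_top : (2 : ℕ∞) ≤ ⊤))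
  have h := (((hd 0).hasFDerivAt.smul_const (cart 1)).sub
    ((hd 1).hasFDerivAt.smul_const (cart 0))).fderiv
  have h' : fderiv ℝ (streamField ψ) x = _ := h
  rw [divergence, h', Fin.sum_univ_two]
  simp [h2, cart_apply, hsymm.eq (cart 0) (cart 1)]

/-- The field of a compactly supported stream function belongs to `V`. -/
theorem exists_mem_V_streamField (ψ : 𝓓(Ω, ℝ)) :
    ∃ w ∈ V Ω, ∀ j, val (w j) =ᵐ[volume.restrict (Ω : Set Plane)] fun x => streamField ψ x j := by
  have hts : tsupport (streamField ψ) ⊆ tsupport ψ :=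
    closure_minimal (support_streamField_subset ψ) (isClosed_tsupport _)
  let φ : 𝓓(Ω, Plane) := ⟨streamField ψ, contDiff_streamField ψ.contDiff,
    ψ.hasCompactSupport.mono' (support_streamField_subset ψ), hts.trans ψ.tsupport_subset⟩
  have hcomp : ∀ j, ∃ u : W12 Ω, val u =ᵐ[volume.restrict (Ω : Set Plane)] fun x => φ x j := by
    intro j
    have hsub : Function.support (fun x => φ x j) ⊆ Function.support φ :=
      fun x hx h => hx (by simp [h])
    exact exists_mem_testScalar ⟨fun x => φ x j,
      (EuclideanSpace.proj (𝕜 := ℝ) j : Plane →L[ℝ] ℝ).contDiff.comp φ.contDiff,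
      φ.hasCompactSupport.mono hsub, (closure_mono hsub).trans φ.tsupport_subset⟩
  choose u hu using hcomp
  refine ⟨WithLp.toLp 2 u, Submodule.le_topologicalClosure _ ?_, hu⟩
  exact ⟨φ, divergence_streamField ψ.contDiff, hu⟩

/-- The centre of the bumps used for a pair with positive coupling. -/
def bumpCenter (A : ℝ) : Plane := ((1 + A) / 2) • cart 1

/-- The centre is at the middle radius `(1 + A) / 2`, at distance `1 / 2` from both boundary
circles. -/
theorem closedBall_bumpCenter_subset {A : ℝ} (hA : 0 < A) {r : ℝ} (hr : r < 1 / 2) :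
    Metric.closedBall (bumpCenter A) r ⊆ annulus A := by
  intro x hx
  have hn : ‖bumpCenter A‖ = (1 + A) / 2 := by
    simp [bumpCenter, norm_smul, cart, abs_of_pos (show 0 < 1 + A by linarith)]
  rw [mem_closedBall_iff_norm] at hx
  have h1 := abs_le.1 (abs_norm_sub_norm_le x (bumpCenter A))
  rw [hn] at h1
  exact ⟨by linarith, by linarith⟩

theorem pos_of_mem_closedBall_bumpCenter {A : ℝ} (hA : 0 < A) {r : ℝ} (hr : r < 1 / 2) {x : Plane}
    (hx : x ∈ Metric.closedBall (bumpCenter A) r) : 0 < x 1 := by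
  rw [mem_closedBall_iff_norm] at hx
  have h1 := (PiLp.norm_apply_le (x - bumpCenter A) 1).trans hx
  have h2 : (x - bumpCenter A) 1 = x 1 - (1 + A) / 2 := by simp [bumpCenter, cart]
  rw [h2, Real.norm_eq_abs] at h1
  linarith [(abs_le.1 h1).1]

/-- A bump as a test function. -/
def bumpTest {A : ℝ} (hA : 0 < A) (f : ContDiffBump (bumpCenter A)) (hf : f.rOut < 1 / 2) :
    𝓓(annulus A, ℝ) :=
  ⟨f, f.contDiff, f.hasCompactSupport, by
    rw [f.tsupport_eq]
    exact closedBall_bumpCenter_subset hA hf⟩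

/-- A bump times the horizontal coordinate as a test function. -/
def bumpStream {A : ℝ} (hA : 0 < A) (f : ContDiffBump (bumpCenter A)) (hf : f.rOut < 1 / 2) :
    𝓓(annulus A, ℝ) :=
  ⟨fun x => f x * x 0,
    f.contDiff.mul (EuclideanSpace.proj (𝕜 := ℝ) 0 : Plane →L[ℝ] ℝ).contDiff,
    f.hasCompactSupport.mul_right,
    (tsupport_mul_subset_left).trans (bumpTest hA f hf).tsupport_subset⟩

/-- Where the cutoff equals one the stream function is the coordinate `y`, whose field is `e_z`. -/
theorem streamField_bumpStream {A : ℝ} (hA : 0 < A) (f : ContDiffBump (bumpCenter A))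
    (hf : f.rOut < 1 / 2) {x : Plane} (hx : x ∈ Metric.ball (bumpCenter A) f.rIn) :
    streamField (bumpStream hA f hf) x = cart 1 := by
  have h1 : (bumpStream hA f hf : Plane → ℝ) =ᶠ[nhds x]
      (EuclideanSpace.proj (𝕜 := ℝ) 0 : Plane →L[ℝ] ℝ) := by
    filter_upwards [f.eventuallyEq_one_of_mem_ball hx] with y hy
    change f y * y 0 = y 0
    rw [hy, Pi.one_apply, one_mul]
  rw [streamField, h1.fderiv_eq, ContinuousLinearMap.fderiv]
  simp [cart]

theorem geomB_pos {A : ℝ} (hA : 0 < A) : 0 < geomB A :=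
  Real.log_pos (by linarith [div_pos two_pos hA])

theorem exists_buoyancy_pos {A : ℝ} (hA : 0 < A) :
    ∃ w ∈ V (annulus A), ∃ θ ∈ W12o (annulus A), 0 < buoyancy A w θ := by
  -- Since `1/5 < 1/4`, the cutoff `f` is one on the support of the temperature bump `g`. There `w =
  -- e_z`, and `w_r / r = z / r²` is positive.
  let f : ContDiffBump (bumpCenter A) := ⟨1 / 4, 1 / 3, by norm_num, by norm_num⟩
  let g : ContDiffBump (bumpCenter A) := ⟨1 / 8, 1 / 5, by norm_num, by norm_num⟩
  have hf : f.rOut < 1 / 2 := by norm_num [f]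
  have hg : g.rOut < 1 / 2 := by norm_num [g]
  obtain ⟨w, hwV, hw⟩ := exists_mem_V_streamField (bumpStream hA f hf)
  obtain ⟨θ, hθ⟩ := exists_mem_testScalar (bumpTest hA g hg)
  refine ⟨w, hwV, θ, Submodule.le_topologicalClosure _ ⟨_, hθ⟩, ?_⟩
  have hfield : ∀ x, g x ≠ 0 → streamField (bumpStream hA f hf) x = cart 1 ∧ 0 < x 1 := by
    intro x hx
    have hxb : x ∈ Metric.ball (bumpCenter A) g.rOut := by
      rw [← g.support_eq]
      exact hx
    refine ⟨streamField_bumpStream hA f hf (Metric.ball_subset_ball (by norm_num [f, g]) hxb), ?_⟩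
    exact pos_of_mem_closedBall_bumpCenter hA hg (Metric.ball_subset_closedBall hxb)
  have h1 : 0 < l2 (annulus A) (val θ) (vertical w) := by
    have he : l2 (annulus A) (val θ) (vertical w) = ∫ x in (annulus A : Set Plane), g x := by
      refine integral_congr_ae ?_
      filter_upwards [hθ, hw 1] with x hx1 hx2
      rw [hx1, vertical, hx2]
      change g x * _ = g x
      by_cases h : g x = 0
      · rw [h, zero_mul]
      · simp [(hfield x h).1, cart]
    rw [he, setIntegral_test_eq_integral (bumpTest hA g hg) (f := g) fun x hx => hx]
    exact g.integral_pos
  have h2 : 0 ≤ l2 (annulus A) (val θ) (fun x => radial w x / ‖x‖) := by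
    refine integral_nonneg_of_ae ?_
    filter_upwards [hθ, hw 0, hw 1] with x hx1 hx2 hx3
    rw [hx1, radial, Fin.sum_univ_two, hx2, hx3]
    change 0 ≤ g x * _
    by_cases h : g x = 0
    · rw [h, zero_mul]
    · have hx := (hfield x h).2
      refine mul_nonneg g.nonneg ?_
      rw [(hfield x h).1]
      simp only [cart_apply]
      simp
      positivity
  have := geomB_pos hA
  rw [buoyancy]
  positivity

end Positivity

end AnnulusConvection

end

/-! ### The theorem on the annulus -/

open AnnulusConvection
theorem lemma2p1 (A : ℝ) (hA : 0 < A) :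
    BddAbove (ratios A) ∧ 0 < sSup (ratios A) ∧
    (∃ p : X A, p ≠ 0 ∧ F A p / D A p = sSup (ratios A)) ∧
    ∀ p : X A, p ≠ 0 → F A p / D A p = sSup (ratios A) →
      WeakEulerLagrange A (2 / RaC A) p ∧
      ∀ q : X A, HasDerivAt (fun η : ℝ => F A (p + η • q) / D A (p + η • q)) 0 0 := by
  obtain ⟨C, hC, hP⟩ := exists_norm_sq_le_dirichlet (isBounded_annulus A)
  have hlam : 2 / RaC A = 2 * sSup (ratios A) := by rw [RaC, one_div, div_inv_eq_mul]
  unfold WeakEulerLagrange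
  rw [hlam]
  refine coupled_rayleigh_quotient (W := W12 (annulus A)) (valL (annulus A))
    (radialMultiplier hA) (1 / geomB A) (S := V (annulus A)) (S₀ := W12o (annulus A))
    (B := buoyancy A) (E := dirichletVec) (E₀ := dirichlet) (d := wderivL (annulus A))
    (c := (C + 1)⁻¹) (Q := ratios A) (buoyancy_eq hA)
    (fun u v => Finset.sum_congr rfl fun j _ => dirichlet_eq _ _) dirichlet_eq (by positivity)
    (fun u hu => ?_) (fun w hw j => apply_mem_W12o hw j)
    (fun u hu R hR => exists_tendsto_subseq (isBounded_annulus A) hu hR)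
    (exists_buoyancy_pos hA) rfl
  -- The full norm adds `‖u‖₂² ≤ C ‖u‖_D²` to the Dirichlet integral, hence the constant `C + 1`.
  rw [inv_mul_le_iff₀ (by positivity)]
  linarith [norm_sq_eq u, hP u hu]
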